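/- Let $n\ge 1$, $p\in(1,2)\cup(2,\infty)$, $0<R_1<R_2$, $O\in\mathbb R^n$, and let $\Omega=\{x\in\mathbb R^n: R_1<|x-O|<R_2\}$. Put $\chi(p)=1$ for $p<2$ and $\chi(p)=0$ for $p>2$. Let $f\in C(\overline\Omega)$ be radially symmetric about $O$, $f(x)=f(r)$ with $r=|x-O|$, and suppose that either $f>0$ on $\overline\Omega$ (put $\operatorname{Sgn}(f)=1$) or $f<0$ on $\overline\Omega$ (put $\operatorname{Sgn}(f)=-1$). For $\varepsilon>0$ consider the minimization problem $$(\mathscr P^{(\varepsilon)}):\quad \min_{u\in\mathscr N} I^{(\varepsilon)}[u],\qquad I^{(\varepsilon)}[u]=\frac1p\int_\Omega\big(|\nabla u|^2+\chi(p)\varepsilon^2\big)^{p/2}dx-\int_\Omega fu\,dx,$$ where $\mathscr N$ is the set of all $u\in W_0^{1,p}(\Omega)\cap C(\overline\Omega)$ that are radially symmetric about $O$, and its Euler–Lagrange equation $$(3)\quad \operatorname{div}\Big(\big(|\nabla u|^2+\chi(p)\varepsilon^2\big)^{(p-2)/2}\nabla u\Big)+f=0\ \text{ in }\Omega,\qquad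 u=0\ \text{ on }\partial\Omega.$$ Let $E_{\varepsilon,p}(r)=r^{(2p-2)/(p-2)}-\chi(p)\varepsilon^2r^2$. For each $\varepsilon>0$, $E_{\varepsilon,p}$ is strictly decreasing on $(0,\varepsilon^{p-2}]$ if $p\in(1,2)$ and strictly increasing on $[0,\infty)$ if $p\in(2,\infty)$, and it maps the respective interval bijectively onto $[0,\infty)$; let $E_{\varepsilon,p}^{-1}$ be its inverse. Then there are a family $(C_\varepsilon)_{\varepsilon>0}$ of positive numbers and a family $(\bar u_\varepsilon)_{\varepsilon>0}$ in $\mathscr N$ such that for every $\varepsilon>0$: $\bar u_\varepsilon$ is a global minimizer of $I^{(\varepsilon)}$ over $\mathscr N$; $\bar u_\varepsilon$ solves (3), in the sense that $\bar u_\varepsilon$ and the flux $(|\nabla\bar u_\varepsilon|^2+\chi(p)\varepsilon^2)^{(p-2)/2}\nabla\bar u_\varepsilon$ are continuously differentiable in $\Omega$ and (3) holds at every point of $\Omega$ and of $\partial\Omega$; and $\bar u_\varepsilon(x)=\bar u_\varepsilon(r)$, $r=|x-O|$, has the explicit form $$\bar u_\varepsilon(r)=\int_{R_1}^r\frac{F_\varepsilon(\rho)\,\rho}{E_{\varepsilon,p}^{-1}\big(F_\varepsilon(\rho)^2\rho^2\big)}\,d\rho,\qquad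 F_\varepsilon(r)=\operatorname{Sgn}(f)\frac{R_1^nC_\varepsilon}{r^n}+\int_r^{R_1}\frac{f(\rho)\rho^{n-1}}{r^n}\,d\rho,\qquad r\in[R_1,R_2],$$ where the integrand is read as $0$ where $F_\varepsilon(\rho)=0$, and $C_\varepsilon$ is the unique positive number for which the boundary condition $\bar u_\varepsilon(R_2)=0$ holds. -/

import Mathlib

open MeasureTheory Set Filter Topology
open scoped ContDiff

noncomputable section

namespace PLap

/-- Euclidean space `ℝⁿ`. -/
abbrev Rn (n : ℕ) : Type := EuclideanSpace ℝ (Fin n)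

/-- The open annulus `{x : R₁ < |x - O| < R₂}`. -/
def annulus {n : ℕ} (O : Rn n) (R₁ R₂ : ℝ) : Set (Rn n) :=
  Metric.ball O R₂ \ Metric.closedBall O R₁

/-- Smooth functions with compact support contained in `Ω`. -/
def IsTestFunction {n : ℕ} (Ω : Set (Rn n)) (φ : Rn n → ℝ) : Prop :=
  ContDiff ℝ ∞ φ ∧ HasCompactSupport φ ∧ tsupport φ ⊆ Ω

/-- `g` is a weak (distributional) gradient of `u` on `Ω`. -/
def HasWeakGradient {n : ℕ} (Ω : Set (Rn n)) (u : Rn n → ℝ) (g : Rn n → Rn n) : Prop :=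
  LocallyIntegrableOn u Ω ∧ LocallyIntegrableOn g Ω ∧
    ∀ φ : Rn n → ℝ, IsTestFunction Ω φ → ∀ i : Fin n,
      ∫ x in Ω, u x * gradient φ x i = -∫ x in Ω, g x i * φ x

open Classical in
/-- The weak gradient of `u` on `Ω` (unique up to a null set when it exists; `0` if none exists). -/
def weakGrad {n : ℕ} (Ω : Set (Rn n)) (u : Rn n → ℝ) : Rn n → Rn n :=
  if h : ∃ g, HasWeakGradient Ω u g then h.choose else 0

/-- The Sobolev space `W^{1,p}(Ω)`. -/
def MemW1p {n : ℕ} (p : ℝ) (Ω : Set (Rn n)) (u : Rn n → ℝ) : Prop :=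
  (∃ g, HasWeakGradient Ω u g) ∧
    MemLp u (ENNReal.ofReal p) (volume.restrict Ω) ∧
    MemLp (weakGrad Ω u) (ENNReal.ofReal p) (volume.restrict Ω)

/-- `W₀^{1,p}(Ω)`: the closure of the test functions in `W^{1,p}(Ω)`. -/
def MemW1pZero {n : ℕ} (p : ℝ) (Ω : Set (Rn n)) (u : Rn n → ℝ) : Prop :=
  MemW1p p Ω u ∧ ∃ φ : ℕ → Rn n → ℝ, (∀ k, IsTestFunction Ω (φ k)) ∧
    Tendsto (fun k => eLpNorm (fun x => u x - φ k x) (ENNReal.ofReal p) (volume.restrict Ω))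
      atTop (𝓝 0) ∧
    Tendsto (fun k => eLpNorm (fun x => weakGrad Ω u x - gradient (φ k) x) (ENNReal.ofReal p)
      (volume.restrict Ω)) atTop (𝓝 0)

/-- On `S`, the function `u` is radially symmetric about `O` with profile `u₀`. -/
def HasRadialProfile {n : ℕ} (O : Rn n) (S : Set (Rn n)) (u : Rn n → ℝ) (u₀ : ℝ → ℝ) : Prop :=
  ∀ x ∈ S, u x = u₀ (dist x O)

/-- The feasible space `𝒩`: radially symmetric functions in `W₀^{1,p}(Ω) ∩ C(closure Ω)`. -/
def feasible {n : ℕ} (p : ℝ) (O : Rn n) (R₁ R₂ : ℝ) : Set (Rn n → ℝ) :=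
  {u | MemW1pZero p (annulus O R₁ R₂) u ∧ ContinuousOn u (closure (annulus O R₁ R₂)) ∧
    ∃ u₀ : ℝ → ℝ, HasRadialProfile O (closure (annulus O R₁ R₂)) u u₀}

/-- The cut-off `χ(p)`: `1` for `p < 2`, `0` for `p > 2`. -/
def chi (p : ℝ) : ℝ := if p < 2 then 1 else 0

/-- The stored energy density `H_{ε,p}(γ) = (|γ|² + χ(p) ε²)^{p/2} / p`. -/
def storedEnergy {n : ℕ} (ε p : ℝ) (γ : Rn n) : ℝ :=
  (‖γ‖ ^ 2 + chi p * ε ^ 2) ^ (p / 2) / p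

/-- The potential energy `I^{(ε)}[u] = ∫_Ω H_{ε,p}(∇u) - ∫_Ω f u`. -/
def potentialEnergy {n : ℕ} (ε p : ℝ) (Ω : Set (Rn n)) (f : Rn n → ℝ) (u : Rn n → ℝ) : ℝ :=
  (∫ x in Ω, storedEnergy ε p (weakGrad Ω u x)) - ∫ x in Ω, f x * u x

/-- The flux `(|∇u|² + χ(p) ε²)^{(p-2)/2} ∇u`, with the classical gradient. -/
def flux {n : ℕ} (ε p : ℝ) (u : Rn n → ℝ) (x : Rn n) : Rn n :=
  ((‖gradient u x‖ ^ 2 + chi p * ε ^ 2) ^ ((p - 2) / 2)) • gradient u x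

/-- The divergence `∑ᵢ ∂ᵢ Vᵢ` of a vector field. -/
def divergence {n : ℕ} (V : Rn n → Rn n) (x : Rn n) : ℝ :=
  ∑ i : Fin n, fderiv ℝ V x (EuclideanSpace.single i 1) i

/-- Classical solutions of `div((|∇u|² + χ(p) ε²)^{(p-2)/2} ∇u) + f = 0` in `Ω`, `u = 0` on `∂Ω`:
both `u` and the flux are continuously differentiable in `Ω` and the equation holds pointwise. -/
structure IsEulerLagrangeSolution {n : ℕ} (ε p : ℝ) (Ω : Set (Rn n)) (f u : Rn n → ℝ) : Prop where
  contDiffOn : ContDiffOn ℝ 1 u Ω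
  contDiffOn_flux : ContDiffOn ℝ 1 (flux ε p u) Ω
  equation : ∀ x ∈ Ω, divergence (flux ε p u) x + f x = 0
  boundary : ∀ x ∈ frontier Ω, u x = 0

/-- `E_{ε,p}(r) = r^{(2p-2)/(p-2)} - χ(p) ε² r²`. -/
def Efun (ε p r : ℝ) : ℝ := r ^ ((2 * p - 2) / (p - 2)) - chi p * ε ^ 2 * r ^ 2

/-- The interval on which `E_{ε,p}` is inverted: `(0, ε^{p-2}]` for `p < 2`, `[0, ∞)` for `p > 2`. -/
def Edom (ε p : ℝ) : Set ℝ := if p < 2 then Ioc 0 (ε ^ (p - 2)) else Ici 0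

/-- The inverse of `E_{ε,p}` on `Edom ε p`. -/
def Einv (ε p : ℝ) : ℝ → ℝ := Function.invFunOn (Efun ε p) (Edom ε p)

/-- `F(r) = s R₁ⁿ C / rⁿ + ∫_r^{R₁} f₀(ρ) ρ^{n-1} / rⁿ dρ`, where `s` is the sign of `f₀`. -/
def Ffun (n : ℕ) (R₁ : ℝ) (f₀ : ℝ → ℝ) (s C r : ℝ) : ℝ :=
  s * R₁ ^ n * C / r ^ n + ∫ ρ in r..R₁, f₀ ρ * ρ ^ (n - 1) / r ^ n

/-- `∫_{R₁}^r F(ρ) ρ / E_{ε,p}⁻¹(F(ρ)² ρ²) dρ`. -/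
def explicitProfile (n : ℕ) (ε p R₁ : ℝ) (f₀ : ℝ → ℝ) (s C r : ℝ) : ℝ :=
  ∫ ρ in R₁..r, Ffun n R₁ f₀ s C ρ * ρ / Einv ε p (Ffun n R₁ f₀ s C ρ ^ 2 * ρ ^ 2)

end PLap

end

namespace PLap

/-! The energy is convex, so a solution of the Euler–Lagrange equation with bounded flux is a
minimizer; it suffices to construct a radial one. If the flux is `F(r)(x - O)`, its divergence is
`nF + rF' = r^{1-n}(r^n F)'`, so the equation fixes `r^n F` up to the constant `C`. The slope `t` is
recovered from `y = F r` by inverting the scalar flux `y = θt`, where `θ = (t² + χε²)^{(p-2)/2}`: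
eliminating `t` gives `E(θ) = y²`, hence `t = y / E⁻¹(y²)` (`scalarFlux_invFlux`). This inverse is
strictly increasing, so, up to the sign of `f`, the boundary value at `R₂` is strictly increasing in
`C`; it is negative at `C = 0` and nonnegative for some larger `C`, which singles out `C`
(`exists_unique_slope_integral_eq_zero`).

Two approximation arguments make this rigorous in Sobolev terms. `memW1pZero_radial` puts a radial
primitive in `W₀^{1,p}` by approximating its derivative by functions of mean zero.
`setIntegral_inner_weakGrad` extends the weak equation from test functions to `W₀^{1,p}` by density.
With the tangent inequality `storedEnergy_add_inner_le` this gives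
`IsEulerLagrangeSolution.isMinOn`, where the competitors need not be radial. -/

lemma chi_of_lt {p : ℝ} (h : p < 2) : chi p = 1 := if_pos h

lemma chi_of_gt {p : ℝ} (h : 2 < p) : chi p = 0 := if_neg h.not_gt

lemma chi_nonneg (p : ℝ) : 0 ≤ chi p := by
  unfold chi; split_ifs <;> norm_num

/-! ### Monotonicity and bijectivity of `E` -/

lemma Efun_strictAntiOn {ε p : ℝ} (hp : 1 < p) (hp2 : p < 2) :
    StrictAntiOn (Efun ε p) (Ioi 0) := by
  intro a ha b hb hab
  have hq : (2 * p - 2) / (p - 2) < 0 := div_neg_of_pos_of_neg (by linarith) (by linarith)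
  have h1 := Real.rpow_lt_rpow_of_neg (mem_Ioi.1 ha) hab hq
  have h2 : a ^ 2 ≤ b ^ 2 := pow_le_pow_left₀ (mem_Ioi.1 ha).le hab.le 2
  have h3 : chi p * ε ^ 2 * a ^ 2 ≤ chi p * ε ^ 2 * b ^ 2 :=
    mul_le_mul_of_nonneg_left h2 (mul_nonneg (chi_nonneg p) (sq_nonneg ε))
  simp only [Efun]
  linarith

lemma Efun_strictMonoOn {ε p : ℝ} (hp2 : 2 < p) : StrictMonoOn (Efun ε p) (Ici 0) := by
  intro a ha b hb hab
  have hq : 0 < (2 * p - 2) / (p - 2) := div_pos (by linarith) (by linarith)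
  simpa [Efun, chi_of_gt hp2] using Real.rpow_lt_rpow (mem_Ici.1 ha) hab hq

/-- The endpoint `ε^{p-2}` is the positive zero of `E`, and the negative exponent makes `E` blow up
at `0⁺`; the intermediate value theorem gives surjectivity. -/
lemma Efun_bijOn_of_lt {ε p : ℝ} (hε : 0 < ε) (hp : 1 < p) (hp2 : p < 2) :
    BijOn (Efun ε p) (Ioc 0 (ε ^ (p - 2))) (Ici 0) := by
  have hq : (2 * p - 2) / (p - 2) < 0 := div_neg_of_pos_of_neg (by linarith) (by linarith)
  set q := (2 * p - 2) / (p - 2) with hqdef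
  set b := ε ^ (p - 2) with hb
  have hb0 : 0 < b := Real.rpow_pos_of_pos hε _
  have hanti : StrictAntiOn (Efun ε p) (Ioi 0) := Efun_strictAntiOn hp hp2
  have hbq : b ^ q = ε ^ 2 * b ^ 2 := by
    have : (p - 2) * q = 2 + (p - 2) * 2 := by
      rw [hqdef]; field_simp [(by linarith : p - 2 ≠ 0)]; ring
    rw [hb, ← Real.rpow_mul hε.le, this, Real.rpow_add hε, Real.rpow_mul hε.le]
    norm_num
  have hEb : Efun ε p b = 0 := by
    rw [Efun, ← hqdef, hbq, chi_of_lt hp2]; ring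
  refine ⟨fun r hr => ?_, (hanti.mono fun r hr => hr.1).injOn, fun y hy => ?_⟩
  · rw [mem_Ici, ← hEb]
    exact hanti.antitoneOn hr.1 hb0 hr.2
  · have hM : 0 < y + b ^ q := add_pos_of_nonneg_of_pos hy (Real.rpow_pos_of_pos hb0 _)
    -- Chosen so that `a^q - y = ε²b²`, which dominates the subtracted term `ε²a²` as soon as `a ≤
    -- b`.
    set a := (y + b ^ q) ^ q⁻¹ with ha
    have ha0 : 0 < a := Real.rpow_pos_of_pos hM _
    have haq : a ^ q = y + b ^ q := Real.rpow_inv_rpow hM.le hq.ne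
    have hab : a ≤ b := by
      by_contra! h
      have := Real.rpow_lt_rpow_of_neg hb0 h hq
      have := mem_Ici.1 hy
      linarith
    have hEa : y ≤ Efun ε p a := by
      have h2 : a ^ 2 ≤ b ^ 2 := pow_le_pow_left₀ ha0.le hab 2
      have h3 := mul_le_mul_of_nonneg_left h2 (sq_nonneg ε)
      rw [Efun, ← hqdef, haq, chi_of_lt hp2, hbq]
      linarith
    have hcont : ContinuousOn (Efun ε p) (Icc a b) := by
      unfold Efun
      refine ContinuousOn.sub (fun x hx => ?_) (by fun_prop)
      exact (Real.continuousAt_rpow_const _ _ (Or.inl (ha0.trans_le hx.1).ne')).continuousWithinAt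
    obtain ⟨x, hx, hxy⟩ := intermediate_value_Icc' hab hcont
      (show y ∈ Icc (Efun ε p b) (Efun ε p a) from ⟨by rw [hEb]; exact hy, hEa⟩)
    exact ⟨x, ⟨ha0.trans_le hx.1, hx.2⟩, hxy⟩

lemma Efun_bijOn_of_gt {ε p : ℝ} (hp2 : 2 < p) : BijOn (Efun ε p) (Ici 0) (Ici 0) := by
  have hq : 0 < (2 * p - 2) / (p - 2) := div_pos (by linarith) (by linarith)
  refine ⟨fun r hr => ?_, (Efun_strictMonoOn hp2).injOn, fun y hy => ?_⟩
  · simpa [Efun, chi_of_gt hp2] using Real.rpow_nonneg (mem_Ici.1 hr) _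
  · refine ⟨y ^ ((2 * p - 2) / (p - 2))⁻¹, Real.rpow_nonneg hy _, ?_⟩
    rw [Efun, chi_of_gt hp2, Real.rpow_inv_rpow hy hq.ne']
    ring

lemma Efun_bijOn {ε p : ℝ} (hε : 0 < ε) (hp : 1 < p) (hp2 : p ≠ 2) :
    BijOn (Efun ε p) (Edom ε p) (Ici 0) := by
  unfold Edom
  split_ifs with h
  · exact Efun_bijOn_of_lt hε hp h
  · exact Efun_bijOn_of_gt (lt_of_le_of_ne (not_lt.1 h) hp2.symm)

/-! ### The scalar flux and its inverse -/

/-- The scalar flux `t ↦ (t² + χ(p) ε²)^{(p-2)/2} t`. -/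
noncomputable def scalarFlux (ε p t : ℝ) : ℝ := (t ^ 2 + chi p * ε ^ 2) ^ ((p - 2) / 2) * t

/-- The inverse of the scalar flux, expressed through `Einv`. -/
noncomputable def invFlux (ε p t : ℝ) : ℝ := t / Einv ε p (t ^ 2)

lemma invFlux_neg (ε p t : ℝ) : invFlux ε p (-t) = -invFlux ε p t := by
  simp [invFlux, neg_div]

lemma scalarFlux_neg (ε p t : ℝ) : scalarFlux ε p (-t) = -scalarFlux ε p t := by
  simp [scalarFlux]

lemma scalarFlux_zero (ε p : ℝ) : scalarFlux ε p 0 = 0 := by simp [scalarFlux]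

lemma invFlux_zero (ε p : ℝ) : invFlux ε p 0 = 0 := by simp [invFlux]

/-- For `t ≠ 0` put `θ = E⁻¹(t²)`. Dividing `E(θ) = t²` by `θ²` gives `(t/θ)² + χε² = θ^{2/(p-2)}`,
so the nonlinear coefficient at `t/θ` is exactly `θ`. -/
lemma scalarFlux_invFlux {ε p : ℝ} (hε : 0 < ε) (hp : 1 < p) (hp2 : p ≠ 2) (t : ℝ) :
    scalarFlux ε p (invFlux ε p t) = t := by
  -- For `p > 2` one has `E⁻¹(0) = 0`, so `θ` cannot be cancelled; Lean's `0 / 0 = 0` is the stated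
  -- convention for the integrand.
  rcases eq_or_ne t 0 with rfl | ht
  · rw [invFlux_zero, scalarFlux_zero]
  have hsurj := (Efun_bijOn hε hp hp2).surjOn (mem_Ici.2 (sq_nonneg t))
  have hmem : Einv ε p (t ^ 2) ∈ Edom ε p := Function.invFunOn_mem hsurj
  have heq : Efun ε p (Einv ε p (t ^ 2)) = t ^ 2 := Function.invFunOn_eq hsurj
  set θ := Einv ε p (t ^ 2) with hθ
  have hp20 : p - 2 ≠ 0 := sub_ne_zero.2 hp2
  have hθ0 : 0 < θ := by
    unfold Edom at hmem
    split_ifs at hmem with h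
    · exact hmem.1
    · refine lt_of_le_of_ne hmem fun h0 => ht ?_
      have hq : (2 * p - 2) / (p - 2) ≠ 0 := div_ne_zero (by linarith) hp20
      rw [Efun, ← h0, Real.zero_rpow hq] at heq
      simpa using heq.symm
  have hpow : θ ^ ((2 * p - 2) / (p - 2)) = θ ^ (2 / (p - 2)) * θ ^ 2 := by
    rw [← Real.rpow_natCast θ 2, ← Real.rpow_add hθ0]
    congr 1
    field_simp
    push_cast
    ring
  have hg : invFlux ε p t ^ 2 + chi p * ε ^ 2 = θ ^ (2 / (p - 2)) := by
    rw [invFlux, ← hθ, div_pow, ← heq, Efun, hpow]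
    field_simp
    ring
  rw [scalarFlux, hg, ← Real.rpow_mul hθ0.le, invFlux, ← hθ]
  have : 2 / (p - 2) * ((p - 2) / 2) = 1 := by field_simp
  rw [this, Real.rpow_one]
  field_simp

lemma chi_mul_sq_pos_or {ε p : ℝ} (hε : 0 < ε) (hp2 : p ≠ 2) : 0 < chi p * ε ^ 2 ∨ 2 < p := by
  rcases lt_or_gt_of_ne hp2 with h | h
  · left; rw [chi_of_lt h]; positivity
  · exact Or.inr h

lemma chi_mul_sq_nonneg (ε p : ℝ) : 0 ≤ chi p * ε ^ 2 := mul_nonneg (chi_nonneg p) (sq_nonneg ε)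

/-- Written as `(t² + c)^{(p-1)/2} · t/√(t² + c)`, it is a strictly increasing factor, since `p >
1`, times a nondecreasing one; the sign of `p - 2` plays no role. -/
lemma scalarFlux_strictMonoOn {ε p : ℝ} (hp : 1 < p) : StrictMonoOn (scalarFlux ε p) (Ici 0) := by
  intro s hs t ht hst
  have hs0 : 0 ≤ s := hs
  have ht0 : 0 < t := hs0.trans_lt hst
  set c := chi p * ε ^ 2 with hc
  have hc0 : 0 ≤ c := chi_mul_sq_nonneg ε p
  have hT : 0 < t ^ 2 + c := by positivity
  -- When `c = 0`, that is `p > 2`, the factorization breaks down at `0`.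
  rcases hs0.eq_or_lt with h0 | hs0
  · rw [← h0, scalarFlux_zero]
    exact mul_pos (Real.rpow_pos_of_pos hT _) ht0
  have hS : 0 < s ^ 2 + c := by positivity
  have key : ∀ x : ℝ, 0 < x ^ 2 + c →
      scalarFlux ε p x = (x ^ 2 + c) ^ ((p - 1) / 2) * (x / √(x ^ 2 + c)) := by
    intro x hx
    rw [scalarFlux, ← hc, show (p - 2) / 2 = (p - 1) / 2 - 1 / 2 by ring, Real.rpow_sub hx,
      ← Real.sqrt_eq_rpow]
    ring
  rw [key s hS, key t hT]
  have h2 : s ^ 2 < t ^ 2 := pow_lt_pow_left₀ hst hs0.le two_ne_zero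
  refine mul_lt_mul (Real.rpow_lt_rpow hS.le (by linarith) (by linarith)) ?_
    (div_pos hs0 (Real.sqrt_pos.2 hS)) (Real.rpow_nonneg hT.le _)
  rw [div_le_div_iff₀ (Real.sqrt_pos.2 hS) (Real.sqrt_pos.2 hT)]
  refine (pow_le_pow_iff_left₀ (by positivity) (by positivity) two_ne_zero).1 ?_
  rw [mul_pow, mul_pow, Real.sq_sqrt hS.le, Real.sq_sqrt hT.le]
  nlinarith [mul_le_mul_of_nonneg_right h2.le hc0]

lemma scalarFlux_strictMono {ε p : ℝ} (hp : 1 < p) : StrictMono (scalarFlux ε p) :=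
  strictMono_of_odd_strictMonoOn_nonneg (scalarFlux_neg ε p) (scalarFlux_strictMonoOn hp)

lemma invFlux_scalarFlux {ε p : ℝ} (hε : 0 < ε) (hp : 1 < p) (hp2 : p ≠ 2) (t : ℝ) :
    invFlux ε p (scalarFlux ε p t) = t :=
  (scalarFlux_strictMono hp).injective (scalarFlux_invFlux hε hp hp2 _)

lemma invFlux_strictMono {ε p : ℝ} (hε : 0 < ε) (hp : 1 < p) (hp2 : p ≠ 2) :
    StrictMono (invFlux ε p) := by
  intro a b hab
  rw [← (scalarFlux_strictMono (ε := ε) hp).lt_iff_lt, scalarFlux_invFlux hε hp hp2,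
    scalarFlux_invFlux hε hp hp2]
  exact hab

/-- A monotone surjection of `ℝ` has no jumps. -/
lemma continuous_invFlux {ε p : ℝ} (hε : 0 < ε) (hp : 1 < p) (hp2 : p ≠ 2) :
    Continuous (invFlux ε p) :=
  (invFlux_strictMono hε hp hp2).monotone.continuous_of_surjective
    fun t => ⟨_, invFlux_scalarFlux hε hp hp2 t⟩

lemma invFlux_mul_sign {ε p s : ℝ} (hs : s = 1 ∨ s = -1) (t : ℝ) :
    invFlux ε p (s * t) = s * invFlux ε p t := by
  rcases hs with rfl | rfl <;> simp [invFlux_neg]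

/-! ### Weak gradients of `C¹` functions -/

section WeakGradient

variable {n : ℕ}

lemma gradient_apply (u : Rn n → ℝ) (x : Rn n) (i : Fin n) :
    gradient u x i = fderiv ℝ u x (EuclideanSpace.single i 1) := by
  have h : inner ℝ (gradient u x) (EuclideanSpace.single i 1) =
      fderiv ℝ u x (EuclideanSpace.single i 1) := by
    rw [gradient, InnerProductSpace.toDual_symm_apply]
  rw [← h, EuclideanSpace.inner_single_right]
  simp

lemma continuousOn_gradient {Ω : Set (Rn n)} (hΩ : IsOpen Ω) {u : Rn n → ℝ}
    (hu : ContDiffOn ℝ 1 u Ω) : ContinuousOn (gradient u) Ω :=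
  (InnerProductSpace.toDual ℝ (Rn n)).symm.continuous.comp_continuousOn
    (hu.continuousOn_fderiv_of_isOpen hΩ le_rfl)

lemma IsTestFunction.contDiff_one {Ω : Set (Rn n)} {φ : Rn n → ℝ} (hφ : IsTestFunction Ω φ) :
    ContDiff ℝ 1 φ := hφ.1.of_le (by exact_mod_cast le_top)

lemma IsTestFunction.continuous_gradient {Ω : Set (Rn n)} {φ : Rn n → ℝ}
    (hφ : IsTestFunction Ω φ) : Continuous (gradient φ) :=
  (InnerProductSpace.toDual ℝ (Rn n)).symm.continuous.comp
    (hφ.contDiff_one.continuous_fderiv one_ne_zero)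

lemma support_gradient_subset {φ : Rn n → ℝ} (i : Fin n) :
    Function.support (fun x => gradient φ x i) ⊆ tsupport φ := by
  intro x hx
  by_contra h
  apply hx
  change gradient φ x i = 0
  rw [gradient_apply, fderiv_of_notMem_tsupport ℝ h]
  rfl

lemma integrable_mul_of_support_subset {w ψ : Rn n → ℝ} {K Ω : Set (Rn n)} (hK : IsCompact K)
    (hKΩ : K ⊆ Ω) (hw : LocallyIntegrableOn w Ω) (hψ : Continuous ψ)
    (hsupp : Function.support ψ ⊆ K) : Integrable (fun x => w x * ψ x) := by
  rw [← integrableOn_iff_integrable_of_support_subset (s := K)]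
  · exact (hw.integrableOn_compact_subset hKΩ hK).mul_continuousOn hψ.continuousOn hK
  · exact (Function.support_mul_subset_right _ _).trans hsupp

lemma setIntegral_mul_of_support_subset {w ψ : Rn n → ℝ} {Ω : Set (Rn n)}
    (hsupp : Function.support ψ ⊆ Ω) : ∫ x in Ω, w x * ψ x = ∫ x, w x * ψ x := by
  refine setIntegral_eq_integral_of_forall_compl_eq_zero fun x hx => ?_
  rw [Function.notMem_support.1 fun h => hx (hsupp h), mul_zero]

/-- All products live on the compact support of `φ` inside `Ω`, so whole-space integration by parts
applies although `w` is controlled only in `Ω`. -/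
lemma setIntegral_mul_gradient {Ω : Set (Rn n)} (hΩ : IsOpen Ω) {w φ : Rn n → ℝ}
    (hw : ContDiffOn ℝ 1 w Ω) (hφ : IsTestFunction Ω φ) (i : Fin n) :
    ∫ x in Ω, w x * gradient φ x i =
      -∫ x in Ω, fderiv ℝ w x (EuclideanSpace.single i 1) * φ x := by
  have hK : IsCompact (tsupport φ) := hφ.2.1
  have hgs := support_gradient_subset (φ := φ) i
  have hwl : LocallyIntegrableOn w Ω := hw.continuousOn.locallyIntegrableOn hΩ.measurableSet
  have hdw : LocallyIntegrableOn (fun x => fderiv ℝ w x (EuclideanSpace.single i 1)) Ω :=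
    ((hw.continuousOn_fderiv_of_isOpen hΩ le_rfl).clm_apply continuousOn_const).locallyIntegrableOn
      hΩ.measurableSet
  have hcg : Continuous fun x => gradient φ x i :=
    (EuclideanSpace.proj (𝕜 := ℝ) i).continuous.comp hφ.continuous_gradient
  have hφc : Continuous φ := hφ.1.continuous
  rw [setIntegral_mul_of_support_subset (hgs.trans hφ.2.2),
    setIntegral_mul_of_support_subset ((subset_tsupport φ).trans hφ.2.2)]
  have h2 := integrable_mul_of_support_subset hK hφ.2.2 hwl hcg hgs
  simp_rw [gradient_apply] at h2 ⊢
  refine integral_mul_fderiv_eq_neg_fderiv_mul_of_integrable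
    (integrable_mul_of_support_subset hK hφ.2.2 hdw hφc (subset_tsupport φ)) h2
    (integrable_mul_of_support_subset hK hφ.2.2 hwl hφc (subset_tsupport φ))
    (fun x hx => ?_) (fun x _ => hφ.contDiff_one.differentiable one_ne_zero x)
  exact (hw.differentiableOn one_ne_zero).differentiableAt (hΩ.mem_nhds (hφ.2.2 hx))

lemma hasWeakGradient_gradient {Ω : Set (Rn n)} (hΩ : IsOpen Ω) {u : Rn n → ℝ}
    (hu : ContDiffOn ℝ 1 u Ω) : HasWeakGradient Ω u (gradient u) := by
  refine ⟨hu.continuousOn.locallyIntegrableOn hΩ.measurableSet,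
    (continuousOn_gradient hΩ hu).locallyIntegrableOn hΩ.measurableSet, fun φ hφ i => ?_⟩
  simp_rw [gradient_apply u]
  exact setIntegral_mul_gradient hΩ hu hφ i

lemma locallyIntegrableOn_component {Ω : Set (Rn n)} {g : Rn n → Rn n}
    (hg : LocallyIntegrableOn g Ω) (i : Fin n) : LocallyIntegrableOn (fun x => g x i) Ω := by
  intro x hx
  obtain ⟨t, ht, h⟩ := hg x hx
  exact ⟨t, ht, (EuclideanSpace.proj (𝕜 := ℝ) i).integrable_comp h⟩

/-- The fundamental lemma of the calculus of variations, componentwise. It lets the chosen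
`weakGrad` be replaced by the classical gradient. -/
lemma HasWeakGradient.ae_eq {Ω : Set (Rn n)} (hΩ : IsOpen Ω) {u : Rn n → ℝ} {g g' : Rn n → Rn n}
    (hg : HasWeakGradient Ω u g) (hg' : HasWeakGradient Ω u g') :
    g =ᵐ[volume.restrict Ω] g' := by
  have key : ∀ i : Fin n, ∀ᵐ x, x ∈ Ω → g x i - g' x i = 0 := by
    intro i
    have h1 := locallyIntegrableOn_component hg.2.1 i
    have h2 := locallyIntegrableOn_component hg'.2.1 i
    refine hΩ.ae_eq_zero_of_integral_contDiff_smul_eq_zero (h1.sub h2) fun φ hφ hc hs => ?_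
    have i1 := integrable_mul_of_support_subset hc hs h1 hφ.continuous (subset_tsupport φ)
    have i2 := integrable_mul_of_support_subset hc hs h2 hφ.continuous (subset_tsupport φ)
    have e1 := hg.2.2 φ ⟨hφ, hc, hs⟩ i
    have e2 := hg'.2.2 φ ⟨hφ, hc, hs⟩ i
    rw [e1, neg_inj, setIntegral_mul_of_support_subset ((subset_tsupport φ).trans hs),
      setIntegral_mul_of_support_subset ((subset_tsupport φ).trans hs)] at e2
    rw [← sub_eq_zero, ← integral_sub i1 i2] at e2
    rw [← e2]
    exact integral_congr_ae (ae_of_all _ fun x => by simp only [smul_eq_mul]; ring)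
  rw [Filter.EventuallyEq, ae_restrict_iff' hΩ.measurableSet]
  filter_upwards [ae_all_iff.2 key] with x hx hxΩ
  ext i
  exact sub_eq_zero.1 (hx i hxΩ)

lemma weakGrad_spec {Ω : Set (Rn n)} {u : Rn n → ℝ} (h : ∃ g, HasWeakGradient Ω u g) :
    HasWeakGradient Ω u (weakGrad Ω u) := by
  rw [weakGrad, dif_pos h]
  exact h.choose_spec

lemma weakGrad_ae_eq_gradient {Ω : Set (Rn n)} (hΩ : IsOpen Ω) {u : Rn n → ℝ}
    (hu : ContDiffOn ℝ 1 u Ω) : weakGrad Ω u =ᵐ[volume.restrict Ω] gradient u :=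
  (weakGrad_spec ⟨_, hasWeakGradient_gradient hΩ hu⟩).ae_eq hΩ (hasWeakGradient_gradient hΩ hu)

lemma memW1p_of_contDiffOn {p : ℝ} {Ω : Set (Rn n)} (hΩ : IsOpen Ω)
    [IsFiniteMeasure (volume.restrict Ω)] {u : Rn n → ℝ} (hu : ContDiffOn ℝ 1 u Ω) {A B : ℝ}
    (hA : ∀ x ∈ Ω, |u x| ≤ A) (hB : ∀ x ∈ Ω, ‖gradient u x‖ ≤ B) : MemW1p p Ω u := by
  refine ⟨⟨_, hasWeakGradient_gradient hΩ hu⟩, ?_, ?_⟩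
  · exact MemLp.of_bound (hu.continuousOn.aestronglyMeasurable hΩ.measurableSet) A
      ((ae_restrict_iff' hΩ.measurableSet).2 (ae_of_all _ hA))
  · rw [memLp_congr_ae (weakGrad_ae_eq_gradient hΩ hu)]
    exact MemLp.of_bound ((continuousOn_gradient hΩ hu).aestronglyMeasurable hΩ.measurableSet) B
      ((ae_restrict_iff' hΩ.measurableSet).2 (ae_of_all _ hB))

end WeakGradient

/-! ### Limits in `L^p` on finite measure spaces -/

section Convergence

variable {α : Type*} {m : MeasurableSpace α} {μ : Measure α}

/-- Vitali's theorem: a uniform bound gives uniform integrability, since truncation above the level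
`M + 1` leaves nothing. -/
lemma tendsto_eLpNorm_sub_of_bounded [IsFiniteMeasure μ] {E : Type*} [NormedAddCommGroup E]
    {p : ENNReal} (hp : 1 ≤ p) (hp' : p ≠ ⊤) {F : ℕ → α → E} {g : α → E}
    (hF : ∀ k, AEStronglyMeasurable (F k) μ) (hg : AEStronglyMeasurable g μ) {M : ℝ}
    (hFM : ∀ k, ∀ᵐ x ∂μ, ‖F k x‖ ≤ M) (hgM : ∀ᵐ x ∂μ, ‖g x‖ ≤ M)
    (hlim : ∀ᵐ x ∂μ, Tendsto (fun k => F k x) atTop (𝓝 (g x))) :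
    Tendsto (fun k => eLpNorm (fun x => g x - F k x) p μ) atTop (𝓝 0) := by
  have hui : UnifIntegrable F p μ := by
    refine unifIntegrable_of hp hp' hF fun ε hε => ⟨(M + 1).toNNReal, fun k => ?_⟩
    have : indicator {x | (M + 1).toNNReal ≤ ‖F k x‖₊} (F k) =ᵐ[μ] 0 := by
      filter_upwards [hFM k] with x hx
      refine indicator_of_notMem (fun h => ?_) _
      have h1 : M + 1 ≤ ‖F k x‖ := Real.toNNReal_le_iff_le_coe.1 h
      linarith
    rw [eLpNorm_congr_ae this, eLpNorm_zero]
    exact zero_le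
  have h := tendsto_Lp_finite_of_tendsto_ae hp hp' hF (MemLp.of_bound hg M hgM) hui hlim
  refine h.congr fun k => ?_
  rw [eLpNorm_sub_comm]
  rfl

/-- A linear functional with bounded coefficients is continuous for `L¹`, hence for `L^p` on a
finite measure space. It serves for both `∫ ⟨V, ∇v⟩` and `∫ f v`. -/
lemma tendsto_integral_of_tendsto_eLpNorm [IsFiniteMeasure μ] {E : Type*} [NormedAddCommGroup E]
    {p : ENNReal} (hp : 1 ≤ p) {F : ℕ → α → E} {g : α → E} (hF : ∀ k, MemLp (F k) p μ)
    (hg : MemLp g p μ)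
    (hlim : Tendsto (fun k => eLpNorm (fun x => g x - F k x) p μ) atTop (𝓝 0))
    {L : α → E → ℝ} {M : ℝ} (hL : ∀ {h : α → E}, AEStronglyMeasurable h μ →
      AEStronglyMeasurable (fun x => L x (h x)) μ)
    (hLsub : ∀ x a b, L x (a - b) = L x a - L x b)
    (hLM : ∀ᵐ x ∂μ, ∀ a, |L x a| ≤ M * ‖a‖) :
    Tendsto (fun k => ∫ x, L x (F k x) ∂μ) atTop (𝓝 (∫ x, L x (g x) ∂μ)) := by
  have hint : ∀ {h : α → E}, MemLp h p μ → Integrable (fun x => L x (h x)) μ := fun {h} hh =>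
    ((hh.integrable hp).norm.const_mul M).mono' (hL hh.1)
      (by filter_upwards [hLM] with x hx using hx _)
  refine tendsto_integral_of_L1' _ (hL hg.1) (Eventually.of_forall fun k => hint (hF k)) ?_
  have hbound : ∀ k, eLpNorm ((fun x => L x (F k x)) - fun x => L x (g x)) 1 μ ≤
      ENNReal.ofReal M * (eLpNorm (fun x => g x - F k x) p μ *
        μ univ ^ (1 / (1 : ENNReal).toReal - 1 / p.toReal)) := by
    intro k
    refine (eLpNorm_le_mul_eLpNorm_of_ae_le_mul (g := fun x => g x - F k x) (c := M) ?_ 1).trans ?_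
    · filter_upwards [hLM] with x hx
      rw [Pi.sub_apply, ← hLsub, Real.norm_eq_abs, norm_sub_rev]
      exact hx _
    · gcongr
      exact eLpNorm_le_eLpNorm_mul_rpow_measure_univ hp (hg.1.sub (hF k).1)
  have hc : μ univ ^ (1 / (1 : ENNReal).toReal - 1 / p.toReal) ≠ ⊤ := by
    refine ENNReal.rpow_ne_top_of_nonneg ?_ (measure_ne_top _ _)
    rcases eq_or_ne p ⊤ with rfl | hpt
    · simp
    · have : (1 : ℝ) ≤ p.toReal := by
        simpa using (ENNReal.toReal_le_toReal ENNReal.one_ne_top hpt).2 hp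
      simpa using inv_le_one_of_one_le₀ this
  refine tendsto_of_tendsto_of_tendsto_of_le_of_le tendsto_const_nhds ?_ (fun _ => zero_le) hbound
  have h1 := ENNReal.Tendsto.const_mul (a := ENNReal.ofReal M)
    (ENNReal.Tendsto.mul_const hlim (Or.inr hc)) (Or.inr ENNReal.ofReal_ne_top)
  simpa using h1

end Convergence

/-! ### Convexity and minimality -/

section Minimality

variable {n : ℕ}

/-- With `A² = |a|² + c` and `B² = |b|² + c`, Cauchy–Schwarz for `(a, √c)` and `(b, √c)` gives `⟨a,
b⟩ + c ≤ AB`; Young's inequality for `A^{p-1}B` finishes. -/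
lemma storedEnergy_add_inner_le {ε p : ℝ} (hε : 0 < ε) (hp : 1 < p) (hp2 : p ≠ 2) (a b : Rn n) :
    storedEnergy ε p a +
      ((‖a‖ ^ 2 + chi p * ε ^ 2) ^ ((p - 2) / 2)) * inner ℝ a (b - a) ≤ storedEnergy ε p b := by
  have hc0 := chi_mul_sq_nonneg ε p
  have hc := chi_mul_sq_pos_or hε hp2
  unfold storedEnergy
  set c := chi p * ε ^ 2
  set A := √(‖a‖ ^ 2 + c) with hA
  set B := √(‖b‖ ^ 2 + c) with hB
  have hA0 : 0 ≤ A := Real.sqrt_nonneg _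
  have hB0 : 0 ≤ B := Real.sqrt_nonneg _
  have hA2 : A ^ 2 = ‖a‖ ^ 2 + c := Real.sq_sqrt (by positivity)
  have hB2 : B ^ 2 = ‖b‖ ^ 2 + c := Real.sq_sqrt (by positivity)
  have hpow : ∀ X q : ℝ, 0 ≤ X → (X ^ 2) ^ (q / 2) = X ^ q := by
    intro X q hX
    rw [← Real.rpow_natCast, ← Real.rpow_mul hX]
    congr 1
    push_cast; ring
  rw [← hA2, ← hB2, hpow A p hA0, hpow B p hB0, hpow A (p - 2) hA0]
  have hyoung : A ^ (p - 1) * B ≤ (p - 1) / p * A ^ p + B ^ p / p := by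
    have hconj : (p / (p - 1)).HolderConjugate p := (Real.HolderConjugate.conjExponent hp).symm
    have h := Real.young_inequality_of_nonneg (Real.rpow_nonneg hA0 (p - 1)) hB0 hconj
    rw [← Real.rpow_mul hA0] at h
    have h1 : (p - 1) * (p / (p - 1)) = p := by field_simp [(by linarith : p - 1 ≠ 0)]
    rw [h1] at h
    refine h.trans (le_of_eq ?_)
    field_simp
  have hin : inner ℝ a (b - a) = inner ℝ a b - ‖a‖ ^ 2 := by
    rw [inner_sub_right, real_inner_self_eq_norm_sq]
  have hcs : inner ℝ a b + c ≤ A * B := by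
    rw [hA, hB, ← Real.sqrt_mul (by positivity)]
    refine (add_le_add_left (real_inner_le_norm a b) c).trans (Real.le_sqrt_of_sq_le ?_)
    nlinarith [mul_nonneg hc0 (sq_nonneg (‖a‖ - ‖b‖))]
  -- `A = 0` forces `a = 0`; the tangent term then vanishes. Otherwise powers of `A` combine freely.
  rcases hA0.eq_or_lt with h0 | hApos
  · have ha0 : a = 0 := by
      rw [← norm_eq_zero, ← sq_eq_zero_iff]
      nlinarith [sq_nonneg ‖a‖]
    rw [← h0, ha0, inner_zero_left, mul_zero, add_zero, Real.zero_rpow (by linarith), zero_div]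
    exact div_nonneg (Real.rpow_nonneg hB0 _) (by linarith)
  · have hnn : 0 ≤ A ^ (p - 2) := Real.rpow_nonneg hA0 _
    have e1 : A ^ (p - 2) * A = A ^ (p - 1) := by
      rw [← Real.rpow_add_one hApos.ne']; congr 1; ring
    have e2 : A ^ (p - 1) * A = A ^ p := by
      rw [← Real.rpow_add_one hApos.ne']; congr 1; ring
    have h3 : A ^ (p - 2) * inner ℝ a (b - a) ≤ A ^ (p - 1) * B - A ^ p := by
      rw [← e2, ← e1, hin]
      have : inner ℝ a b - ‖a‖ ^ 2 ≤ A * B - A * A := by nlinarith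
      calc _ ≤ A ^ (p - 2) * (A * B - A * A) := mul_le_mul_of_nonneg_left this hnn
        _ = _ := by ring
    have e3 : A ^ p / p + (p - 1) / p * A ^ p = A ^ p := by field_simp; ring
    linarith

lemma continuous_storedEnergy {ε p : ℝ} (hp : 1 < p) :
    Continuous (storedEnergy (n := n) ε p) := by
  unfold storedEnergy
  refine Continuous.div_const (Continuous.rpow_const (by fun_prop) fun x => Or.inr (by linarith)) _

lemma integrable_storedEnergy {ε p : ℝ} (hp : 1 < p) {μ : Measure (Rn n)} [IsFiniteMeasure μ]
    {g : Rn n → Rn n} (hg : MemLp g (ENNReal.ofReal p) μ) :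
    Integrable (fun x => storedEnergy ε p (g x)) μ := by
  have hp0 : 0 < p := by linarith
  have hc0 := chi_mul_sq_nonneg ε p
  set d := √(chi p * ε ^ 2) with hd
  have hm : MemLp (fun x => ‖g x‖ + d) (ENNReal.ofReal p) μ := hg.norm.add (memLp_const d)
  have hi := hm.integrable_norm_rpow (by simpa using hp0) ENNReal.ofReal_ne_top
  rw [ENNReal.toReal_ofReal hp0.le] at hi
  refine (hi.div_const p).mono' ((continuous_storedEnergy hp).comp_aestronglyMeasurable hg.1)
    (ae_of_all _ fun x => ?_)
  have hd0 : 0 ≤ d := Real.sqrt_nonneg _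
  have h0 : 0 ≤ ‖g x‖ ^ 2 + chi p * ε ^ 2 := by positivity
  have h1 : 0 ≤ ‖g x‖ + d := by positivity
  rw [Real.norm_of_nonneg (by unfold storedEnergy; positivity), Real.norm_of_nonneg h1, storedEnergy]
  gcongr
  have : (‖g x‖ + d) ^ p = ((‖g x‖ + d) ^ 2) ^ (p / 2) := by
    rw [← Real.rpow_natCast, ← Real.rpow_mul h1]; congr 1; push_cast; ring
  rw [this]
  gcongr
  nlinarith [Real.sq_sqrt hc0, norm_nonneg (g x)]

lemma IsTestFunction.memLp {Ω : Set (Rn n)} {φ : Rn n → ℝ} (hφ : IsTestFunction Ω φ) (q : ENNReal)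
    (μ : Measure (Rn n)) [IsFiniteMeasure μ] : MemLp φ q μ := by
  obtain ⟨M, hM⟩ := hφ.1.continuous.bounded_above_of_compact_support hφ.2.1
  exact MemLp.of_bound hφ.1.continuous.aestronglyMeasurable M (ae_of_all _ hM)

lemma IsTestFunction.memLp_gradient {Ω : Set (Rn n)} {φ : Rn n → ℝ} (hφ : IsTestFunction Ω φ)
    (q : ENNReal) (μ : Measure (Rn n)) [IsFiniteMeasure μ] : MemLp (gradient φ) q μ := by
  have hs : HasCompactSupport (gradient φ) :=
    (hφ.2.1.fderiv (𝕜 := ℝ)).comp_left (map_zero (InnerProductSpace.toDual ℝ (Rn n)).symm)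
  obtain ⟨M, hM⟩ := hφ.continuous_gradient.bounded_above_of_compact_support hs
  exact MemLp.of_bound hφ.continuous_gradient.aestronglyMeasurable M (ae_of_all _ hM)

lemma setIntegral_inner_gradient {Ω : Set (Rn n)} (hΩ : IsOpen Ω)
    {V : Rn n → Rn n} {φ : Rn n → ℝ} (hV : ContDiffOn ℝ 1 V Ω) (hφ : IsTestFunction Ω φ) :
    ∫ x in Ω, inner ℝ (V x) (gradient φ x) = -∫ x in Ω, divergence V x * φ x := by
  have hVi : ∀ i : Fin n, ContDiffOn ℝ 1 (fun x => V x i) Ω := fun i =>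
    (EuclideanSpace.proj (𝕜 := ℝ) i).contDiff.comp_contDiffOn hV
  have hK : IsCompact (tsupport φ) := hφ.2.1
  have hd : ∀ i : Fin n, ∀ x ∈ Ω, fderiv ℝ (fun y => V y i) x (EuclideanSpace.single i 1) =
      fderiv ℝ V x (EuclideanSpace.single i 1) i := by
    intro i x hx
    have hVd := ((hV.differentiableOn one_ne_zero).differentiableAt (hΩ.mem_nhds hx)).hasFDerivAt
    have := ((EuclideanSpace.proj (𝕜 := ℝ) i).hasFDerivAt.comp x hVd).fderiv
    change fderiv ℝ ((EuclideanSpace.proj (𝕜 := ℝ) i) ∘ V) x _ = _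
    rw [this]
    rfl
  have hVl : ∀ i : Fin n, LocallyIntegrableOn (fun x => V x i) Ω := fun i =>
    (hVi i).continuousOn.locallyIntegrableOn hΩ.measurableSet
  have hdl : ∀ i : Fin n, LocallyIntegrableOn
      (fun x => fderiv ℝ (fun y => V y i) x (EuclideanSpace.single i 1)) Ω := fun i =>
    (((hVi i).continuousOn_fderiv_of_isOpen hΩ le_rfl).clm_apply
      continuousOn_const).locallyIntegrableOn hΩ.measurableSet
  have e1 : ∫ x in Ω, inner ℝ (V x) (gradient φ x) =
      ∑ i, ∫ x in Ω, V x i * gradient φ x i := by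
    rw [← integral_finsetSum]
    · refine integral_congr_ae (ae_of_all _ fun x => ?_)
      simp only [PiLp.inner_apply]
      exact Finset.sum_congr rfl fun i _ => by simp [mul_comm]
    · exact fun i _ => (integrable_mul_of_support_subset hK hφ.2.2 (hVl i)
        ((EuclideanSpace.proj (𝕜 := ℝ) i).continuous.comp hφ.continuous_gradient)
        (support_gradient_subset i)).integrableOn
  have e2 : ∫ x in Ω, divergence V x * φ x =
      ∑ i, ∫ x in Ω, fderiv ℝ (fun y => V y i) x (EuclideanSpace.single i 1) * φ x := by
    rw [← integral_finsetSum]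
    · refine setIntegral_congr_fun hΩ.measurableSet fun x hx => ?_
      simp only [divergence, Finset.sum_mul]
      exact Finset.sum_congr rfl fun i _ => by rw [hd i x hx]
    · exact fun i _ => (integrable_mul_of_support_subset hK hφ.2.2 (hdl i) hφ.1.continuous
        (subset_tsupport φ)).integrableOn
  rw [e1, e2, ← Finset.sum_neg_distrib]
  exact Finset.sum_congr rfl fun i _ => setIntegral_mul_gradient hΩ (hVi i) hφ i

/-- For test functions this is integration by parts; boundedness of `V` and `f` carries it to their
closure. -/
lemma setIntegral_inner_weakGrad {p : ℝ} (hp : 1 < p) {Ω : Set (Rn n)} (hΩ : IsOpen Ω)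
    [IsFiniteMeasure (volume.restrict Ω)] {f v : Rn n → ℝ} {V : Rn n → Rn n}
    (hV : ContDiffOn ℝ 1 V Ω) (hdiv : ∀ x ∈ Ω, divergence V x + f x = 0) {A B : ℝ}
    (hVb : ∀ x ∈ Ω, ‖V x‖ ≤ A) (hfb : ∀ x ∈ Ω, |f x| ≤ B)
    (hfm : AEStronglyMeasurable f (volume.restrict Ω)) (hv : MemW1pZero p Ω v) :
    ∫ x in Ω, inner ℝ (V x) (weakGrad Ω v x) = ∫ x in Ω, f x * v x := by
  obtain ⟨⟨-, hvL, hgL⟩, φ, hφ, h1, h2⟩ := hv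
  have hp1 : 1 ≤ ENNReal.ofReal p := ENNReal.one_le_ofReal.2 hp.le
  have hVm : AEStronglyMeasurable V (volume.restrict Ω) :=
    hV.continuousOn.aestronglyMeasurable hΩ.measurableSet
  have l1 := tendsto_integral_of_tendsto_eLpNorm hp1 (fun k => (hφ k).memLp_gradient _ _) hgL h2
    (L := fun x a => inner ℝ (V x) a) (M := A) (fun hh => hVm.inner hh)
    (fun x a b => inner_sub_right _ _ _)
    ((ae_restrict_iff' hΩ.measurableSet).2 (ae_of_all _ fun x hx a =>
      (abs_real_inner_le_norm _ _).trans (mul_le_mul_of_nonneg_right (hVb x hx) (norm_nonneg a))))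
  have l2 := tendsto_integral_of_tendsto_eLpNorm hp1 (fun k => (hφ k).memLp _ _) hvL h1
    (L := fun x a => f x * a) (M := B) (fun hh => hfm.mul hh)
    (fun x a b => mul_sub _ _ _)
    ((ae_restrict_iff' hΩ.measurableSet).2 (ae_of_all _ fun x hx a => by
      rw [abs_mul]; exact mul_le_mul_of_nonneg_right (hfb x hx) (norm_nonneg a)))
  refine tendsto_nhds_unique l1 (l2.congr fun k => ?_)
  rw [setIntegral_inner_gradient hΩ hV (hφ k), ← integral_neg]
  refine setIntegral_congr_fun hΩ.measurableSet fun x hx => ?_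
  have := hdiv x hx
  simp only [show f x = -divergence V x by linarith]
  ring

/-- Integrate the tangent inequality at `∇u`: testing the equation with `u` and with `v` turns the
linear term into `∫ f (v - u)`. -/
lemma IsEulerLagrangeSolution.isMinOn {ε p : ℝ} (hε : 0 < ε) (hp : 1 < p) (hp2 : p ≠ 2)
    {Ω : Set (Rn n)} (hΩ : IsOpen Ω) [IsFiniteMeasure (volume.restrict Ω)] {f u : Rn n → ℝ}
    (hu : IsEulerLagrangeSolution ε p Ω f u) (huW : MemW1pZero p Ω u) {A B : ℝ}
    (hVb : ∀ x ∈ Ω, ‖flux ε p u x‖ ≤ A) (hfb : ∀ x ∈ Ω, |f x| ≤ B)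
    (hfm : AEStronglyMeasurable f (volume.restrict Ω)) :
    IsMinOn (potentialEnergy ε p Ω f) {v | MemW1pZero p Ω v} u := by
  intro v hv
  have hv : MemW1pZero p Ω v := hv
  have hp1 : 1 ≤ ENNReal.ofReal p := ENNReal.one_le_ofReal.2 hp.le
  have eu := setIntegral_inner_weakGrad hp hΩ hu.contDiffOn_flux hu.equation hVb hfb hfm huW
  have ev := setIntegral_inner_weakGrad hp hΩ hu.contDiffOn_flux hu.equation hVb hfb hfm hv
  have iu := integrable_storedEnergy (ε := ε) hp huW.1.2.2
  have iv := integrable_storedEnergy (ε := ε) hp hv.1.2.2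
  have hVm : AEStronglyMeasurable (flux ε p u) (volume.restrict Ω) :=
    hu.contDiffOn_flux.continuousOn.aestronglyMeasurable hΩ.measurableSet
  have hin : ∀ {g : Rn n → Rn n}, MemLp g (ENNReal.ofReal p) (volume.restrict Ω) →
      Integrable (fun x => inner ℝ (flux ε p u x) (g x)) (volume.restrict Ω) := fun {g} hg =>
    ((hg.integrable hp1).norm.const_mul A).mono' (hVm.inner hg.1)
      ((ae_restrict_iff' hΩ.measurableSet).2 (ae_of_all _ fun x hx =>
        (abs_real_inner_le_norm _ _).trans
          (mul_le_mul_of_nonneg_right (hVb x hx) (norm_nonneg _))))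
  have ju := hin huW.1.2.2
  have jv := hin hv.1.2.2
  have key : ∫ x in Ω, (storedEnergy ε p (weakGrad Ω u x) +
      (inner ℝ (flux ε p u x) (weakGrad Ω v x) - inner ℝ (flux ε p u x) (weakGrad Ω u x))) ≤
      ∫ x in Ω, storedEnergy ε p (weakGrad Ω v x) := by
    refine integral_mono_ae (iu.add (jv.sub ju)) iv ?_
    filter_upwards [weakGrad_ae_eq_gradient hΩ hu.contDiffOn] with x hx
    refine le_trans (le_of_eq ?_)
      (storedEnergy_add_inner_le hε hp hp2 (weakGrad Ω u x) (weakGrad Ω v x))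
    rw [← inner_sub_right, hx, flux, real_inner_smul_left]
  have esub := integral_sub jv ju
  have eadd := integral_add iu (jv.sub ju)
  simp only [Pi.sub_apply] at eadd
  rw [eadd, esub, eu, ev] at key
  change potentialEnergy ε p Ω f u ≤ potentialEnergy ε p Ω f v
  unfold potentialEnergy
  linarith

end Minimality

/-! ### Primitives and mean-zero approximation -/

section Primitive

lemma contDiff_one_primitive {h : ℝ → ℝ} (hh : Continuous h) (a : ℝ) :
    ContDiff ℝ 1 (fun r => ∫ ρ in a..r, h ρ) := by
  have hd : deriv (fun r => ∫ ρ in a..r, h ρ) = h := funext fun r => hh.deriv_integral _ _ _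
  rw [contDiff_one_iff_deriv, hd]
  exact ⟨fun r => (hh.integral_hasStrictDerivAt a r).hasDerivAt.differentiableAt, hh⟩

lemma contDiff_infty_primitive {h : ℝ → ℝ} (hh : ContDiff ℝ ∞ h) (a : ℝ) :
    ContDiff ℝ ∞ (fun r => ∫ ρ in a..r, h ρ) := by
  have hd : deriv (fun r => ∫ ρ in a..r, h ρ) = h :=
    funext fun r => hh.continuous.deriv_integral _ _ _
  rw [contDiff_infty_iff_deriv, hd]
  exact ⟨fun r => (hh.continuous.integral_hasStrictDerivAt a r).hasDerivAt.differentiableAt, hh⟩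

lemma abs_primitive_le {h : ℝ → ℝ} {a b M r : ℝ} (hM : ∀ ρ ∈ Icc a b, |h ρ| ≤ M)
    (hr : r ∈ Icc a b) : |∫ ρ in a..r, h ρ| ≤ M * (b - a) := by
  have hM0 : 0 ≤ M := (abs_nonneg _).trans (hM r hr)
  have h1 := intervalIntegral.norm_integral_le_of_norm_le_const (a := a) (b := r) (f := h) (C := M)
    fun ρ hρ => by
      rw [uIoc_of_le hr.1] at hρ
      exact hM ρ ⟨hρ.1.le, hρ.2.trans hr.2⟩
  refine h1.trans ?_
  rw [abs_of_nonneg (sub_nonneg.2 hr.1)]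
  exact mul_le_mul_of_nonneg_left (by linarith [hr.2]) hM0

lemma tendsto_primitive {h : ℝ → ℝ} {g : ℕ → ℝ → ℝ} {a b M r : ℝ} (hg : ∀ k, Continuous (g k))
    (hM : ∀ k, ∀ ρ ∈ Icc a b, |g k ρ| ≤ M)
    (hlim : ∀ ρ ∈ Ioo a b, Tendsto (fun k => g k ρ) atTop (𝓝 (h ρ))) (hr : r ∈ Icc a b) :
    Tendsto (fun k => ∫ ρ in a..r, g k ρ) atTop (𝓝 (∫ ρ in a..r, h ρ)) := by
  refine intervalIntegral.tendsto_integral_filter_of_dominated_convergence (fun _ => M)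
    (Eventually.of_forall fun k => (hg k).aestronglyMeasurable) (Eventually.of_forall fun k =>
      ae_of_all _ fun ρ hρ => ?_) intervalIntegrable_const ?_
  · rw [uIoc_of_le hr.1] at hρ
    exact hM k ρ ⟨hρ.1.le, hρ.2.trans hr.2⟩
  -- Convergence is assumed only inside the interval; for `r = b` the endpoint is discarded as a
  -- null set.
  · have hb : ∀ᵐ ρ : ℝ, ρ ≠ b := by
      simp [ae_iff]
    filter_upwards [hb] with ρ hρb hρ
    rw [uIoc_of_le hr.1] at hρ
    exact hlim ρ ⟨hρ.1, lt_of_le_of_ne (hρ.2.trans hr.2) hρb⟩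

/-- Smooth compactly supported functions of mean zero approximate a continuous function of mean
zero, boundedly and pointwise. -/
lemma exists_smooth_approx_of_integral_eq_zero {a b : ℝ} (hab : a < b) {h : ℝ → ℝ}
    (hh : Continuous h) (h0 : ∫ ρ in a..b, h ρ = 0) :
    ∃ (g : ℕ → ℝ → ℝ) (M : ℝ), (∀ k, ContDiff ℝ ∞ (g k)) ∧
      (∀ k, ∃ c d, a < c ∧ d < b ∧ (∀ r ≤ c, g k r = 0) ∧ ∀ r, d ≤ r → g k r = 0) ∧
      (∀ k, ∫ ρ in a..b, g k ρ = 0) ∧ (∀ k, ∀ r ∈ Icc a b, |g k r| ≤ M) ∧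
      ∀ r ∈ Ioo a b, Tendsto (fun k => g k r) atTop (𝓝 (h r)) := by
  set L := (b - a) / 2 with hL
  have hL0 : 0 < L := by rw [hL]; linarith
  set m := (a + b) / 2 with hm
  -- Both radii increase to the half-length `L` and stay below it: supports are compact in `(a, b)`,
  -- and each interior point is eventually in the plateau.
  let χ : ℕ → ContDiffBump m := fun k =>
    { rIn := L * ((k + 1) / (k + 3)), rOut := L * ((k + 2) / (k + 3))
      rIn_pos := by positivity
      rIn_lt_rOut := by gcongr; norm_num }
  -- The first bound keeps the support of `χ 0` inside that of every `χ k`, so the mean correction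
  -- below does not enlarge supports.
  have hrOut : ∀ k, (χ 0).rOut ≤ (χ k).rOut ∧ (χ k).rOut < L := by
    intro k
    constructor
    · change L * (((0 : ℕ) + 2) / ((0 : ℕ) + 3)) ≤ L * ((k + 2) / (k + 3))
      refine mul_le_mul_of_nonneg_left ?_ hL0.le
      rw [div_le_div_iff₀ (by positivity) (by positivity)]
      push_cast
      nlinarith [(Nat.cast_nonneg k : (0 : ℝ) ≤ k)]
    · change L * (((k : ℝ) + 2) / (k + 3)) < L
      refine mul_lt_of_lt_one_right hL0 ?_
      rw [div_lt_one (by positivity)]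
      linarith
  have hχ0 : ∀ k r, (χ k).rOut ≤ |r - m| → χ k r = 0 := fun k r hr =>
    (χ k).zero_of_le_dist (by rwa [Real.dist_eq])
  have hχ1 : ∀ k r, |χ k r| ≤ 1 := fun k r => by
    rw [abs_of_nonneg (χ k).nonneg]; exact (χ k).le_one
  have hχlim : ∀ r ∈ Ioo a b, ∀ᶠ k in atTop, χ k r = 1 := by
    intro r hr
    have hlt : |r - m| < L := by
      rw [abs_lt]; constructor <;> [linarith [hr.1]; linarith [hr.2]]
    have hlim : Tendsto (fun k : ℕ => (χ k).rIn) atTop (𝓝 L) := by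
      have h2 : Tendsto (fun k : ℕ => 2 / ((k : ℝ) + 3)) atTop (𝓝 0) :=
        tendsto_const_nhds.div_atTop
          (tendsto_atTop_add_const_right _ _ tendsto_natCast_atTop_atTop)
      have h3 : Tendsto (fun k : ℕ => L * (1 - 2 / ((k : ℝ) + 3))) atTop (𝓝 (L * (1 - 0))) :=
        (tendsto_const_nhds.sub h2).const_mul L
      rw [sub_zero, mul_one] at h3
      refine h3.congr fun k => ?_
      change _ = L * (((k : ℝ) + 1) / (k + 3))
      field_simp
      ring
    filter_upwards [hlim.eventually (lt_mem_nhds hlt)] with k hk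
    refine (χ k).one_of_mem_closedBall ?_
    rw [Metric.mem_closedBall, Real.dist_eq]
    exact hk.le
  have hex : ∀ k : ℕ, ∃ q : Polynomial ℝ, ∀ r ∈ Icc a b, |q.eval r - h r| < 1 / ((k : ℝ) + 1) :=
    fun k => exists_polynomial_near_of_continuousOn a b h hh.continuousOn _ (by positivity)
  choose q hq using hex
  obtain ⟨H, hH⟩ := isCompact_Icc.exists_bound_of_continuousOn (s := Icc a b) hh.continuousOn
  set w : ℕ → ℝ → ℝ := fun k r => χ k r * (q k).eval r with hw
  have hχs : ∀ k, ContDiff ℝ ∞ (χ k) := fun k => (χ k).contDiff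
  have hqs : ∀ k, ContDiff ℝ ∞ fun r => (q k).eval r := fun k => by
    simpa only [Polynomial.coe_aeval_eq_eval] using (q k).contDiff_aeval (𝕜 := ℝ) ∞
  have hws : ∀ k, ContDiff ℝ ∞ (w k) := fun k => (hχs k).mul (hqs k)
  have hwM : ∀ k, ∀ r ∈ Icc a b, |w k r| ≤ H + 1 := by
    intro k r hr
    have h1 : |(q k).eval r| ≤ H + 1 := by
      have h2 := hq k r hr
      have h3 : 1 / ((k : ℝ) + 1) ≤ 1 := by
        rw [div_le_one (by positivity)]; linarith [(Nat.cast_nonneg k : (0 : ℝ) ≤ k)]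
      have h4 : |h r| ≤ H := hH r hr
      have h5 := abs_add_le ((q k).eval r - h r) (h r)
      rw [sub_add_cancel] at h5
      linarith
    rw [hw, abs_mul]
    calc _ ≤ 1 * |(q k).eval r| := mul_le_mul_of_nonneg_right (hχ1 k r) (abs_nonneg _)
      _ ≤ _ := by linarith
  have hwlim : ∀ r ∈ Ioo a b, Tendsto (fun k => w k r) atTop (𝓝 (h r)) := by
    intro r hr
    have hql : Tendsto (fun k => (q k).eval r) atTop (𝓝 (h r)) := by
      rw [tendsto_iff_dist_tendsto_zero]
      exact squeeze_zero (fun _ => dist_nonneg) (fun k => by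
        rw [Real.dist_eq]; exact (hq k r (Ioo_subset_Icc_self hr)).le)
        tendsto_one_div_add_atTop_nhds_zero_nat
    refine hql.congr' ?_
    filter_upwards [hχlim r hr] with k hk
    rw [hw]
    simp [hk]
  set I := ∫ ρ in a..b, χ 0 ρ with hI
  have hI0 : 0 < I := by
    refine intervalIntegral.integral_pos hab (χ 0).continuous.continuousOn
      (fun _ _ => (χ 0).nonneg) ⟨m, ⟨by linarith, by linarith⟩, ?_⟩
    rw [(χ 0).one_of_mem_closedBall (Metric.mem_closedBall_self (χ 0).rIn_pos.le)]
    exact one_pos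
  -- Subtracting `c k * χ 0` restores mean zero; `c k → 0` because `h` itself has mean zero.
  set c : ℕ → ℝ := fun k => (∫ ρ in a..b, w k ρ) / I with hc
  have hclim : Tendsto c atTop (𝓝 0) := by
    have := (tendsto_primitive (fun k => (hws k).continuous) hwM hwlim
      (right_mem_Icc.2 hab.le)).div_const I
    rwa [h0, zero_div] at this
  have hcM : ∀ k, |c k| ≤ (H + 1) * (b - a) / I := fun k => by
    rw [hc, abs_div, abs_of_pos hI0]
    exact div_le_div_of_nonneg_right (abs_primitive_le (hwM k) (right_mem_Icc.2 hab.le)) hI0.le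
  refine ⟨fun k r => w k r - c k * χ 0 r, H + 1 + (H + 1) * (b - a) / I,
    fun k => (hws k).sub (contDiff_const.mul (hχs 0)), fun k => ?_, fun k => ?_,
    fun k r hr => ?_, fun r hr => ?_⟩
  · obtain ⟨h1, h2⟩ := hrOut k
    have hz : ∀ r, (χ k).rOut ≤ |r - m| → w k r - c k * χ 0 r = 0 := fun r hr => by
      rw [hw]
      simp only [hχ0 k r hr, hχ0 0 r (h1.trans hr)]
      ring
    refine ⟨m - (χ k).rOut, m + (χ k).rOut, by linarith, by linarith,
      fun r hr => hz r ?_, fun r hr => hz r ?_⟩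
    · rw [abs_sub_comm]; exact le_trans (by linarith) (le_abs_self _)
    · exact le_trans (by linarith) (le_abs_self _)
  · rw [intervalIntegral.integral_sub ((hws k).continuous.intervalIntegrable _ _)
      (((χ 0).continuous.const_mul _).intervalIntegrable _ _),
      intervalIntegral.integral_const_mul, ← hI, hc]
    field_simp
    ring
  · refine (abs_sub _ _).trans (add_le_add (hwM k r hr) ?_)
    rw [abs_mul]
    calc _ ≤ |c k| * 1 := mul_le_mul_of_nonneg_left (hχ1 0 r) (abs_nonneg _)
      _ ≤ _ := by rw [mul_one]; exact hcM k
  · have := (hwlim r hr).sub (hclim.mul_const (χ 0 r))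
    simpa using this

end Primitive

/-! ### Radial functions and membership in `W₀^{1,p}` -/

section Radial

variable {n : ℕ}

lemma mem_annulus {O x : Rn n} {R₁ R₂ : ℝ} :
    x ∈ annulus O R₁ R₂ ↔ R₁ < dist x O ∧ dist x O < R₂ := by
  simp [annulus, and_comm]

lemma isOpen_annulus (O : Rn n) (R₁ R₂ : ℝ) : IsOpen (annulus O R₁ R₂) :=
  Metric.isOpen_ball.sdiff Metric.isClosed_closedBall

lemma isFiniteMeasure_restrict_annulus (O : Rn n) (R₁ R₂ : ℝ) :
    IsFiniteMeasure (volume.restrict (annulus O R₁ R₂)) :=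
  isFiniteMeasure_restrict.2
    ((measure_mono sdiff_subset).trans_lt (measure_ball_lt_top (x := O) (r := R₂))).ne

lemma dist_mem_Icc_of_mem_closure {O x : Rn n} {R₁ R₂ : ℝ}
    (hx : x ∈ closure (annulus O R₁ R₂)) : dist x O ∈ Icc R₁ R₂ := by
  have hcl : IsClosed {y : Rn n | dist y O ∈ Icc R₁ R₂} :=
    isClosed_Icc.preimage (continuous_id.dist continuous_const)
  refine closure_minimal (fun y hy => ?_) hcl hx
  obtain ⟨h1, h2⟩ := mem_annulus.1 hy
  exact ⟨h1.le, h2.le⟩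

lemma contDiffAt_dist {O x : Rn n} (hx : x ≠ O) {k : WithTop ℕ∞} :
    ContDiffAt ℝ k (fun y => dist y O) x :=
  contDiffAt_id.dist ℝ contDiffAt_const hx

lemma ne_of_mem_annulus {O x : Rn n} {R₁ R₂ : ℝ} (hR₁ : 0 < R₁) (hx : x ∈ annulus O R₁ R₂) :
    x ≠ O :=
  dist_pos.1 (hR₁.trans (mem_annulus.1 hx).1)

lemma hasGradientAt_radial {O x : Rn n} (hx : x ≠ O) {U : ℝ → ℝ} {d : ℝ}
    (hU : HasDerivAt U d (dist x O)) :
    HasGradientAt (fun y => U (dist y O)) ((d / dist x O) • (x - O)) x := by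
  have hpos : 0 < ‖x - O‖ := norm_pos_iff.2 (sub_ne_zero.2 hx)
  have h1 : HasFDerivAt (fun y : Rn n => ‖y - O‖ ^ 2) (2 • (innerSL ℝ) (x - O)) x := by
    simpa using ((hasFDerivAt_id x).sub_const O).norm_sq
  have h2 := h1.sqrt (by positivity)
  have h3 : (fun y : Rn n => √(‖y - O‖ ^ 2)) = fun y => dist y O := by
    ext y
    rw [Real.sqrt_sq (norm_nonneg _), dist_eq_norm]
  rw [h3, Real.sqrt_sq (norm_nonneg _), ← dist_eq_norm] at h2
  have h4 := hU.comp_hasFDerivAt x h2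
  refine hasGradientAt_iff_hasFDerivAt.2 ?_
  refine h4.congr_fderiv ?_
  ext v
  have hd : dist x O ≠ 0 := by rw [dist_eq_norm]; exact hpos.ne'
  simp
  field_simp

lemma norm_smul_sub {O x : Rn n} (hx : x ≠ O) (d : ℝ) : ‖(d / dist x O) • (x - O)‖ = |d| := by
  have hd : 0 < dist x O := dist_pos.2 hx
  rw [norm_smul, ← dist_eq_norm, Real.norm_eq_abs, abs_div, abs_of_pos hd]
  field_simp

lemma contDiffOn_radial {O : Rn n} {R₁ R₂ : ℝ} (hR₁ : 0 < R₁) {U : ℝ → ℝ} (hU : ContDiff ℝ 1 U) :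
    ContDiffOn ℝ 1 (fun x => U (dist x O)) (annulus O R₁ R₂) := fun x hx =>
  (hU.contDiffAt.comp x (contDiffAt_dist (ne_of_mem_annulus hR₁ hx))).contDiffWithinAt

lemma isTestFunction_radial {O : Rn n} {R₁ R₂ c d : ℝ} (hR₁ : 0 < R₁) (hc : R₁ < c) (hd : d < R₂)
    {ψ : ℝ → ℝ} (hψ : ContDiff ℝ ∞ ψ) (hψc : ∀ r ≤ c, ψ r = 0) (hψd : ∀ r, d ≤ r → ψ r = 0) :
    IsTestFunction (annulus O R₁ R₂) (fun x => ψ (dist x O)) := by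
  have hcl : IsClosed {x : Rn n | dist x O ∈ Icc c d} :=
    isClosed_Icc.preimage (continuous_id.dist continuous_const)
  have hK : IsCompact {x : Rn n | dist x O ∈ Icc c d} :=
    (isCompact_closedBall O d).of_isClosed_subset hcl fun x hx => hx.2
  have hs : Function.support (fun x : Rn n => ψ (dist x O)) ⊆ {x | dist x O ∈ Icc c d} := by
    intro x hx
    refine ⟨?_, ?_⟩
    · by_contra! h
      exact hx (hψc _ h.le)
    · by_contra! h
      exact hx (hψd _ h.le)
  refine ⟨contDiff_iff_contDiffAt.2 fun x => ?_, HasCompactSupport.of_support_subset_isCompact hK hs,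
    (closure_minimal hs hcl).trans fun x hx => mem_annulus.2 ⟨hc.trans_le hx.1, hx.2.trans_lt hd⟩⟩
  -- The distance is not smooth at `O`, but the composite vanishes near `O`.
  rcases eq_or_ne x O with rfl | hx
  · refine (contDiffAt_const (c := (0 : ℝ))).congr_of_eventuallyEq ?_
    filter_upwards [Metric.ball_mem_nhds x (hR₁.trans hc)] with y hy
    exact hψc _ (Metric.mem_ball.1 hy).le
  · exact hψ.contDiffAt.comp x (contDiffAt_dist hx)

/-- The derivative is approximated instead of the function. A primitive of `g k` vanishes near `R₁`
by the support of `g k`, and near and beyond `R₂` because `g k` has mean zero; bounded pointwise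
convergence then handles values and gradients. -/
lemma memW1pZero_radial {p : ℝ} (hp : 1 < p) (O : Rn n) {R₁ R₂ : ℝ} (hR₁ : 0 < R₁) (hR : R₁ < R₂)
    {h : ℝ → ℝ} (hh : Continuous h) (h0 : ∫ ρ in R₁..R₂, h ρ = 0) :
    MemW1pZero p (annulus O R₁ R₂) (fun x => ∫ ρ in R₁..dist x O, h ρ) := by
  have hΩ := isOpen_annulus O R₁ R₂
  have hfin := isFiniteMeasure_restrict_annulus O R₁ R₂
  have hp1 : 1 ≤ ENNReal.ofReal p := ENNReal.one_le_ofReal.2 hp.le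
  obtain ⟨H, hH⟩ := isCompact_Icc.exists_bound_of_continuousOn (s := Icc R₁ R₂) hh.continuousOn
  have hIcc : ∀ {x : Rn n}, x ∈ annulus O R₁ R₂ → dist x O ∈ Icc R₁ R₂ := fun hx =>
    dist_mem_Icc_of_mem_closure (subset_closure hx)
  have hu : ContDiffOn ℝ 1 (fun x => ∫ ρ in R₁..dist x O, h ρ) (annulus O R₁ R₂) :=
    contDiffOn_radial hR₁ (contDiff_one_primitive hh R₁)
  have hgrad : ∀ {g : ℝ → ℝ}, Continuous g → ∀ x ∈ annulus O R₁ R₂,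
      gradient (fun x => ∫ ρ in R₁..dist x O, g ρ) x = (g (dist x O) / dist x O) • (x - O) :=
    fun {g} hg x hx => (hasGradientAt_radial (ne_of_mem_annulus hR₁ hx)
      (hg.integral_hasStrictDerivAt R₁ _).hasDerivAt).gradient
  have hgnorm : ∀ {g : ℝ → ℝ}, Continuous g → ∀ x ∈ annulus O R₁ R₂,
      ‖gradient (fun x => ∫ ρ in R₁..dist x O, g ρ) x‖ = |g (dist x O)| := fun {g} hg x hx => by
    rw [hgrad hg x hx, norm_smul_sub (ne_of_mem_annulus hR₁ hx)]
  have hae : ∀ {P : Rn n → Prop}, (∀ x ∈ annulus O R₁ R₂, P x) →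
      ∀ᵐ x ∂volume.restrict (annulus O R₁ R₂), P x := fun hP =>
    (ae_restrict_iff' hΩ.measurableSet).2 (ae_of_all _ hP)
  have hgm := (continuousOn_gradient hΩ hu).aestronglyMeasurable (μ := volume) hΩ.measurableSet
  have hum := hu.continuousOn.aestronglyMeasurable (μ := volume) hΩ.measurableSet
  obtain ⟨g, M, hgs, hgsupp, hg0, hgM, hglim⟩ := exists_smooth_approx_of_integral_eq_zero hR hh h0
  have hgc : ∀ k, Continuous (g k) := fun k => (hgs k).continuous
  have hφ : ∀ k, IsTestFunction (annulus O R₁ R₂) (fun x => ∫ ρ in R₁..dist x O, g k ρ) := by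
    intro k
    obtain ⟨c, d, hc, hd, hgc0, hgd0⟩ := hgsupp k
    refine isTestFunction_radial hR₁ hc hd (contDiff_infty_primitive (hgs k) R₁)
      (fun r hr => ?_) (fun r hr => ?_)
    · rw [intervalIntegral.integral_congr (g := fun _ => 0), intervalIntegral.integral_zero]
      intro ρ hρ
      exact hgc0 ρ (hρ.2.trans (max_le hc.le hr))
    · have e1 : ∫ ρ in R₂..r, g k ρ = 0 := by
        rw [intervalIntegral.integral_congr (g := fun _ => 0), intervalIntegral.integral_zero]
        intro ρ hρ
        exact hgd0 ρ ((le_min hd.le hr).trans hρ.1)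
      rw [← intervalIntegral.integral_add_adjacent_intervals
        ((hgc k).intervalIntegrable R₁ R₂) ((hgc k).intervalIntegrable R₂ r), hg0, e1, add_zero]
  refine ⟨memW1p_of_contDiffOn hΩ hu (A := H * (R₂ - R₁)) (B := H)
    (fun x hx => abs_primitive_le hH (hIcc hx)) (fun x hx => ?_),
    fun k x => ∫ ρ in R₁..dist x O, g k ρ, hφ, ?_, ?_⟩
  · rw [hgnorm hh x hx]
    exact hH _ (hIcc hx)
  · refine tendsto_eLpNorm_sub_of_bounded hp1 ENNReal.ofReal_ne_top
      (fun k => (hφ k).1.continuous.aestronglyMeasurable) hum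
      (M := max M H * (R₂ - R₁)) (fun k => hae fun x hx => ?_) (hae fun x hx => ?_)
      (hae fun x hx => ?_)
    · exact abs_primitive_le (fun ρ hρ => (hgM k ρ hρ).trans (le_max_left _ _)) (hIcc hx)
    · exact abs_primitive_le (fun ρ hρ => (hH ρ hρ).trans (le_max_right _ _)) (hIcc hx)
    · exact tendsto_primitive hgc hgM hglim (hIcc hx)
  · have hlim := tendsto_eLpNorm_sub_of_bounded (μ := volume.restrict (annulus O R₁ R₂)) hp1
      ENNReal.ofReal_ne_top
      (F := fun k => gradient fun x => ∫ ρ in R₁..dist x O, g k ρ)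
      (fun k => (hφ k).continuous_gradient.aestronglyMeasurable) hgm
      (M := max M H) (fun k => hae fun x hx => ?_) (hae fun x hx => ?_) (hae fun x hx => ?_)
    · refine hlim.congr fun k => eLpNorm_congr_ae ?_
      filter_upwards [weakGrad_ae_eq_gradient hΩ hu] with x hx
      rw [hx]
    · rw [hgnorm (hgc k) x hx]
      exact (hgM k _ (hIcc hx)).trans (le_max_left _ _)
    · rw [hgnorm hh x hx]
      exact (hH _ (hIcc hx)).trans (le_max_right _ _)
    · rw [hgrad hh x hx]
      simp_rw [hgrad (hgc _) x hx]
      exact ((hglim _ (mem_annulus.1 hx)).div_const _).smul_const _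

end Radial

/-! ### Divergence of a radial field -/

section Divergence

variable {n : ℕ}

/-- Product rule: `div(x - O) = n`, and `∇F(r) · (x - O) = rF'(r)`. -/
lemma divergence_radial {O x : Rn n} (hx : x ≠ O) {F : ℝ → ℝ} {d : ℝ}
    (hF : HasDerivAt F d (dist x O)) {V : Rn n → Rn n}
    (hV : V =ᶠ[𝓝 x] fun y => F (dist y O) • (y - O)) :
    divergence V x = n * F (dist x O) + d * dist x O := by
  have hd : dist x O ≠ 0 := dist_ne_zero.2 hx
  have h1 : HasFDerivAt (fun y => F (dist y O) • (y - O)) _ x :=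
    (hasGradientAt_radial hx hF).hasFDerivAt.smul ((hasFDerivAt_id x).sub_const O)
  have h2 : ∑ i : Fin n, (x - O) i * (x - O) i = dist x O ^ 2 := by
    rw [dist_eq_norm, EuclideanSpace.norm_sq_eq]
    exact Finset.sum_congr rfl fun i _ => by rw [Real.norm_eq_abs, sq_abs, sq]
  have h3 : divergence V x = ∑ i : Fin n, (F (dist x O) +
      d / dist x O * ((x - O) i * (x - O) i)) := by
    unfold divergence
    rw [hV.fderiv_eq, h1.fderiv]
    refine Finset.sum_congr rfl fun i _ => ?_
    simp [EuclideanSpace.inner_single_right]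
    ring
  rw [h3, Finset.sum_add_distrib, ← Finset.mul_sum, h2]
  simp
  field_simp

end Divergence

/-! ### The radial profile and the constant `C` -/

section Profile

/-- `∫_{R₁}^r s f(ρ) ρ^{n-1} dρ`. -/
noncomputable def massFun (n : ℕ) (R₁ s : ℝ) (f : ℝ → ℝ) (r : ℝ) : ℝ :=
  ∫ ρ in R₁..r, s * f ρ * ρ ^ (n - 1)

/-- The slope `|∇u|` up to sign, extended to the left of `R₁` by a constant. -/
noncomputable def slope (n : ℕ) (ε p R₁ s : ℝ) (f : ℝ → ℝ) (C r : ℝ) : ℝ :=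
  invFlux ε p ((R₁ ^ n * C - massFun n R₁ s f (max R₁ r)) / max R₁ r ^ n * max R₁ r)

variable {n : ℕ} {ε p R₁ R₂ s : ℝ} {f : ℝ → ℝ}

/-- Since `s² = 1`, the sign factors out and only the positive density `s f` remains in the bracket.
-/
lemma Ffun_eq (hs : s = 1 ∨ s = -1) (C r : ℝ) :
    Ffun n R₁ f s C r = s * ((R₁ ^ n * C - massFun n R₁ s f r) / r ^ n) := by
  have h1 : massFun n R₁ s f r = -(s * ∫ ρ in r..R₁, f ρ * ρ ^ (n - 1)) := by
    rw [massFun, intervalIntegral.integral_symm, ← intervalIntegral.integral_const_mul]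
    simp_rw [mul_assoc]
  rw [Ffun, intervalIntegral.integral_div, h1]
  have hs2 : s * s = 1 := by rcases hs with rfl | rfl <;> norm_num
  linear_combination (-(∫ ρ in r..R₁, f ρ * ρ ^ (n - 1)) / r ^ n) * hs2

lemma integrand_eq_slope (hs : s = 1 ∨ s = -1) {C ρ : ℝ} (hρ : R₁ ≤ ρ) :
    Ffun n R₁ f s C ρ * ρ / Einv ε p (Ffun n R₁ f s C ρ ^ 2 * ρ ^ 2) =
      s * slope n ε p R₁ s f C ρ := by
  rw [← mul_pow, ← invFlux, slope, max_eq_right hρ, Ffun_eq hs, mul_assoc, invFlux_mul_sign hs]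

lemma Ffun_congr {g : ℝ → ℝ} (hfg : EqOn f g (Icc R₁ R₂)) {C r : ℝ} (hr : r ∈ Icc R₁ R₂) :
    Ffun n R₁ f s C r = Ffun n R₁ g s C r := by
  unfold Ffun
  congr 1
  refine intervalIntegral.integral_congr fun ρ hρ => ?_
  rw [uIcc_of_ge hr.1] at hρ
  simp only [hfg ⟨hρ.1, hρ.2.trans hr.2⟩]

/-- Only values on `[R₁, R₂]` enter, so the given profile may be exchanged for a globally continuous
one. -/
lemma explicitProfile_eq {g : ℝ → ℝ} (hs : s = 1 ∨ s = -1) (hfg : EqOn f g (Icc R₁ R₂)) {C r : ℝ}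
    (hr : r ∈ Icc R₁ R₂) :
    explicitProfile n ε p R₁ f s C r = ∫ ρ in R₁..r, s * slope n ε p R₁ s g C ρ := by
  refine intervalIntegral.integral_congr fun ρ hρ => ?_
  rw [uIcc_of_le hr.1] at hρ
  simp only [Ffun_congr hfg ⟨hρ.1, hρ.2.trans hr.2⟩, integrand_eq_slope hs hρ.1]

lemma continuous_massFun_integrand (hf : Continuous f) :
    Continuous fun ρ => s * f ρ * ρ ^ (n - 1) := by fun_prop

lemma contDiff_massFun (hf : Continuous f) : ContDiff ℝ 1 (massFun n R₁ s f) :=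
  contDiff_one_primitive (continuous_massFun_integrand hf) R₁

lemma massFun_pos (hf : Continuous f) (hpos : ∀ r, 0 < s * f r) (hR₁ : 0 < R₁) {r : ℝ}
    (hr : R₁ < r) : 0 < massFun n R₁ s f r :=
  intervalIntegral.intervalIntegral_pos_of_pos_on
    ((continuous_massFun_integrand hf).intervalIntegrable _ _)
    (fun ρ hρ => mul_pos (hpos ρ) (pow_pos (hR₁.trans hρ.1) _)) hr

lemma massFun_le (hf : Continuous f) (hpos : ∀ r, 0 < s * f r) (hR₁ : 0 < R₁) {r : ℝ}
    (hr : R₁ ≤ r) (hr2 : r ≤ R₂) : massFun n R₁ s f r ≤ massFun n R₁ s f R₂ := by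
  have hi := fun a b => (continuous_massFun_integrand (n := n) (s := s) hf).intervalIntegrable
    (μ := volume) a b
  have h1 := intervalIntegral.integral_add_adjacent_intervals (hi R₁ r) (hi r R₂)
  have h2 : 0 ≤ ∫ ρ in r..R₂, s * f ρ * ρ ^ (n - 1) :=
    intervalIntegral.integral_nonneg hr2 fun ρ hρ =>
      mul_nonneg (hpos ρ).le (pow_nonneg (hR₁.le.trans (hr.trans hρ.1)) _)
  unfold massFun
  linarith

/-- The truncation `max R₁ r` keeps the denominator away from `0`, so continuity is joint and
global; the parametric integral and the `C¹` primitive rely on this. -/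
lemma continuous_slope (hε : 0 < ε) (hp : 1 < p) (hp2 : p ≠ 2) (hR₁ : 0 < R₁)
    (hf : Continuous f) : Continuous (Function.uncurry (slope n ε p R₁ s f)) := by
  unfold slope
  have hm := (contDiff_massFun (n := n) (R₁ := R₁) (s := s) hf).continuous
  have hr : Continuous fun q : ℝ × ℝ => max R₁ q.2 := by fun_prop
  refine (continuous_invFlux hε hp hp2).comp (Continuous.mul (Continuous.div ?_ (hr.pow n) ?_) hr)
  · exact ((continuous_const.mul continuous_fst).sub (hm.comp hr))
  · exact fun q => pow_ne_zero _ (hR₁.trans_le (le_max_left _ _)).ne'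

lemma continuous_slope_right (hε : 0 < ε) (hp : 1 < p) (hp2 : p ≠ 2) (hR₁ : 0 < R₁)
    (hf : Continuous f) (C : ℝ) : Continuous (slope n ε p R₁ s f C) :=
  (continuous_slope hε hp hp2 hR₁ hf).comp (Continuous.prodMk_right C)

lemma continuous_mul_slope (hε : 0 < ε) (hp : 1 < p) (hp2 : p ≠ 2) (hR₁ : 0 < R₁)
    (hf : Continuous f) (C : ℝ) : Continuous fun ρ => s * slope n ε p R₁ s f C ρ :=
  continuous_const.mul (continuous_slope_right hε hp hp2 hR₁ hf C)

lemma slope_strictMono (hε : 0 < ε) (hp : 1 < p) (hp2 : p ≠ 2) (hR₁ : 0 < R₁) (r : ℝ) :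
    StrictMono fun C => slope n ε p R₁ s f C r := by
  intro C C' h
  have hr : 0 < max R₁ r := hR₁.trans_le (le_max_left _ _)
  refine invFlux_strictMono hε hp hp2 ?_
  gcongr

/-- The integral is continuous and strictly increasing in the constant. At `0` the slope is negative
on `(R₁, R₂)`, which makes the root positive. -/
lemma exists_unique_slope_integral_eq_zero (hε : 0 < ε) (hp : 1 < p) (hp2 : p ≠ 2) (hR₁ : 0 < R₁)
    (hR : R₁ < R₂) (hf : Continuous f) (hpos : ∀ r, 0 < s * f r) :
    ∃ C, 0 < C ∧ ∀ y, ∫ ρ in R₁..R₂, slope n ε p R₁ s f y ρ = 0 ↔ y = C := by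
  have hc := continuous_slope_right (n := n) (s := s) hε hp hp2 hR₁ hf
  set Φ : ℝ → ℝ := fun C => ∫ ρ in R₁..R₂, slope n ε p R₁ s f C ρ with hΦ
  have hmono : StrictMono Φ := fun C C' h =>
    intervalIntegral.integral_lt_integral_of_continuousOn_of_le_of_exists_lt hR
      (hc C).continuousOn (hc C').continuousOn
      (fun r _ => (slope_strictMono hε hp hp2 hR₁ r h).le)
      ⟨R₁, left_mem_Icc.2 hR.le, slope_strictMono hε hp hp2 hR₁ R₁ h⟩
  have hcont : Continuous Φ := intervalIntegral.continuous_parametric_intervalIntegral_of_continuous'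
    (continuous_slope hε hp hp2 hR₁ hf) _ _
  have hzero : Φ 0 < 0 := by
    have h := intervalIntegral.intervalIntegral_pos_of_pos_on
      (f := fun r => -slope n ε p R₁ s f 0 r) ((hc 0).neg.intervalIntegrable R₁ R₂)
      (fun r hr => ?_) hR
    · rw [intervalIntegral.integral_neg] at h
      exact neg_pos.1 h
    · have hr0 : 0 < r := hR₁.trans hr.1
      have hneg := massFun_pos (n := n) hf hpos hR₁ hr.1
      rw [neg_pos, slope, max_eq_right hr.1.le]
      refine (invFlux_strictMono hε hp hp2 (b := 0) ?_).trans_eq (invFlux_zero ε p)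
      refine mul_neg_of_neg_of_pos (div_neg_of_neg_of_pos ?_ (pow_pos hr0 n)) hr0
      simpa using hneg
  -- With this value `R₁^n C₀` is the total mass, so no slope on `[R₁, R₂]` is negative.
  set C₀ := massFun n R₁ s f R₂ / R₁ ^ n with hC₀
  have hC₀pos : 0 < C₀ := div_pos (massFun_pos hf hpos hR₁ hR) (pow_pos hR₁ n)
  have hbig : 0 ≤ Φ C₀ := by
    refine intervalIntegral.integral_nonneg hR.le fun r hr => ?_
    have hr0 : 0 < r := hR₁.trans_le hr.1
    rw [slope, max_eq_right hr.1, ← invFlux_zero ε p]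
    refine (invFlux_strictMono hε hp hp2).monotone ?_
    refine mul_nonneg (div_nonneg ?_ (pow_pos hr0 n).le) hr0.le
    rw [hC₀, mul_div_cancel₀ _ (pow_pos hR₁ n).ne']
    exact sub_nonneg.2 (massFun_le hf hpos hR₁ hr.1 hr.2)
  obtain ⟨C, hC, hC0⟩ := intermediate_value_Icc hC₀pos.le hcont.continuousOn
    (show (0 : ℝ) ∈ Icc (Φ 0) (Φ C₀) from ⟨hzero.le, hbig⟩)
  refine ⟨C, lt_of_le_of_ne hC.1 ?_, fun y => ⟨fun hy => ?_, ?_⟩⟩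
  · rintro rfl
    exact hzero.ne hC0
  · exact hmono.injective (hy.trans hC0.symm)
  · rintro rfl
    exact hC0

lemma scalarFlux_slope (hε : 0 < ε) (hp : 1 < p) (hp2 : p ≠ 2) (hs : s = 1 ∨ s = -1) (C : ℝ)
    {r : ℝ} (hr : R₁ ≤ r) :
    scalarFlux ε p (s * slope n ε p R₁ s f C r) = Ffun n R₁ f s C r * r := by
  rw [slope, max_eq_right hr, ← invFlux_mul_sign hs, scalarFlux_invFlux hε hp hp2, Ffun_eq hs,
    mul_assoc]

lemma contDiffAt_Ffun (hs : s = 1 ∨ s = -1) (hf : Continuous f) (C : ℝ) {r : ℝ} (hr : 0 < r) :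
    ContDiffAt ℝ 1 (Ffun n R₁ f s C) r := by
  rw [funext (Ffun_eq hs C)]
  exact contDiffAt_const.mul ((contDiffAt_const.sub (contDiff_massFun hf).contDiffAt).div
    (contDiffAt_id.pow n) (pow_pos hr n).ne')

/-- This is `(r^n F)' = -r^{n-1} f` solved for `F'`. -/
lemma hasDerivAt_Ffun (hn : 1 ≤ n) (hs : s = 1 ∨ s = -1) (hf : Continuous f) (C : ℝ) {r : ℝ}
    (hr : 0 < r) :
    HasDerivAt (Ffun n R₁ f s C) (-(f r + n * Ffun n R₁ f s C r) / r) r := by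
  have h1 : HasDerivAt (massFun n R₁ s f) (s * f r * r ^ (n - 1)) r :=
    ((continuous_massFun_integrand hf).integral_hasStrictDerivAt R₁ r).hasDerivAt
  have h2 := ((h1.const_sub (R₁ ^ n * C)).div (hasDerivAt_pow n r) (pow_pos hr n).ne').const_mul s
  rw [Ffun_eq hs, funext (Ffun_eq hs C)]
  refine h2.congr_deriv ?_
  -- Makes the truncated exponent `n - 1` a genuine one.
  obtain ⟨k, rfl⟩ : ∃ k, n = k + 1 := ⟨n - 1, by omega⟩
  have hs2 : s ^ 2 = 1 := by rcases hs with rfl | rfl <;> norm_num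
  simp only [Nat.add_sub_cancel]
  field_simp
  linear_combination (-(r ^ 2 * r ^ (2 * k) * f r)) * hs2

end Profile

/-! ### The radial solution -/

section Solution

variable {n : ℕ} {ε p R₁ R₂ s : ℝ} {O : Rn n} {f : ℝ → ℝ}

lemma flux_radial {h : ℝ → ℝ} (hh : Continuous h) {x : Rn n} (hx : x ≠ O) :
    flux ε p (fun x => ∫ ρ in R₁..dist x O, h ρ) x =
      (scalarFlux ε p (h (dist x O)) / dist x O) • (x - O) := by
  have hg := (hasGradientAt_radial hx
    (hh.integral_hasStrictDerivAt R₁ (dist x O)).hasDerivAt).gradient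
  rw [flux, hg, norm_smul_sub hx, sq_abs, smul_smul, scalarFlux, mul_div_assoc]

/-- Inverting the scalar flux was designed for this: the nonlinearity cancels, and the flux is `C¹`
although the slope is only known to be continuous. -/
lemma flux_solution (hε : 0 < ε) (hp : 1 < p) (hp2 : p ≠ 2) (hR₁ : 0 < R₁) (hs : s = 1 ∨ s = -1)
    (hf : Continuous f) (C : ℝ) {x : Rn n} (hx : x ∈ annulus O R₁ R₂) :
    flux ε p (fun x => ∫ ρ in R₁..dist x O, s * slope n ε p R₁ s f C ρ) x =
      Ffun n R₁ f s C (dist x O) • (x - O) := by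
  have hxO := ne_of_mem_annulus hR₁ hx
  rw [flux_radial (continuous_mul_slope hε hp hp2 hR₁ hf C) hxO,
    scalarFlux_slope hε hp hp2 hs C (mem_annulus.1 hx).1.le,
    mul_div_cancel_right₀ _ (dist_ne_zero.2 hxO)]

lemma isEulerLagrangeSolution_radial (hn : 1 ≤ n) (hε : 0 < ε) (hp : 1 < p) (hp2 : p ≠ 2)
    (hR₁ : 0 < R₁) (hs : s = 1 ∨ s = -1) (hf : Continuous f) {C : ℝ}
    (hC : ∫ ρ in R₁..R₂, s * slope n ε p R₁ s f C ρ = 0) {φ : Rn n → ℝ}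
    (hφ : HasRadialProfile O (closure (annulus O R₁ R₂)) φ f) :
    IsEulerLagrangeSolution ε p (annulus O R₁ R₂) φ
      (fun x => ∫ ρ in R₁..dist x O, s * slope n ε p R₁ s f C ρ) where
  contDiffOn := contDiffOn_radial hR₁
    (contDiff_one_primitive (continuous_mul_slope hε hp hp2 hR₁ hf C) R₁)
  contDiffOn_flux := by
    have h : ContDiffOn ℝ 1 (fun x => Ffun n R₁ f s C (dist x O) • (x - O)) (annulus O R₁ R₂) := by
      intro x hx
      have hxO := ne_of_mem_annulus hR₁ hx
      exact (((contDiffAt_Ffun hs hf C (dist_pos.2 hxO)).comp x (contDiffAt_dist hxO)).smul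
        (contDiffAt_id.sub contDiffAt_const)).contDiffWithinAt
    exact h.congr fun x hx => flux_solution hε hp hp2 hR₁ hs hf C hx
  equation x hx := by
    have hxO := ne_of_mem_annulus hR₁ hx
    have hd : 0 < dist x O := dist_pos.2 hxO
    rw [divergence_radial hxO (hasDerivAt_Ffun hn hs hf C hd)
      (by filter_upwards [(isOpen_annulus O R₁ R₂).mem_nhds hx] with y hy using
        flux_solution hε hp hp2 hR₁ hs hf C hy), hφ x (subset_closure hx)]
    field_simp
    ring
  boundary x hx := by
    rw [(isOpen_annulus O R₁ R₂).frontier_eq] at hx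
    obtain ⟨h1, h2⟩ := dist_mem_Icc_of_mem_closure hx.1
    rcases h1.eq_or_lt with h1 | h1
    · simp only [← h1, intervalIntegral.integral_same]
    · have h3 : dist x O = R₂ :=
        h2.eq_of_not_lt fun h2 => hx.2 (mem_annulus.2 ⟨h1, h2⟩)
      simp only [h3, hC]

lemma exists_norm_flux_le (hε : 0 < ε) (hp : 1 < p) (hp2 : p ≠ 2) (hR₁ : 0 < R₁)
    (hs : s = 1 ∨ s = -1) (hf : Continuous f) (C : ℝ) :
    ∃ A, ∀ x ∈ annulus O R₁ R₂,
      ‖flux ε p (fun x => ∫ ρ in R₁..dist x O, s * slope n ε p R₁ s f C ρ) x‖ ≤ A := by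
  have hc : ContinuousOn (fun r => Ffun n R₁ f s C r * r) (Icc R₁ R₂) := fun r hr =>
    ((contDiffAt_Ffun hs hf C (hR₁.trans_le hr.1)).continuousAt.mul
      continuousAt_id).continuousWithinAt
  obtain ⟨A, hA⟩ := isCompact_Icc.exists_bound_of_continuousOn hc
  refine ⟨A, fun x hx => ?_⟩
  rw [flux_solution hε hp hp2 hR₁ hs hf C hx, norm_smul, ← dist_eq_norm]
  have := hA _ (dist_mem_Icc_of_mem_closure (subset_closure hx))
  rwa [norm_mul, Real.norm_of_nonneg (dist_nonneg (x := x) (y := O))] at this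

end Solution

/-! ### Continuity and sign of the radial datum -/

section RadialData

variable {n : ℕ} {R₁ R₂ : ℝ} {O : Rn n}

lemma exists_unit_ray (hn : 1 ≤ n) (O : Rn n) (hR₁ : 0 < R₁) (hR : R₁ < R₂) :
    ∃ γ : ℝ → Rn n, Continuous γ ∧
      ∀ r ∈ Icc R₁ R₂, γ r ∈ closure (annulus O R₁ R₂) ∧ dist (γ r) O = r := by
  set e : Rn n := EuclideanSpace.single ⟨0, hn⟩ 1 with he
  have hγ : Continuous fun r : ℝ => O + r • e := by fun_prop
  have hdist : ∀ r : ℝ, 0 ≤ r → dist (O + r • e) O = r := fun r hr => by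
    rw [dist_eq_norm, add_sub_cancel_left, norm_smul, he, PiLp.norm_single,
      Real.norm_of_nonneg hr, norm_one, mul_one]
  refine ⟨fun r => O + r • e, hγ, fun r hr => ⟨?_, hdist r (hR₁.le.trans hr.1)⟩⟩
  -- The endpoint radii reach the closure of the annulus as limits along the ray.
  rw [← closure_Ioo hR.ne] at hr
  refine map_mem_closure (f := fun r => O + r • e) hγ hr fun ρ hρ => mem_annulus.2 ?_
  simp only [hdist ρ (hR₁.trans hρ.1).le]
  exact hρ

lemma sign_mul_pos {s y : ℝ} (hs : s = 1 ∨ s = -1) (h : Real.sign y = s) : 0 < s * y := by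
  rcases lt_trichotomy y 0 with hy | hy | hy
  · rw [← h, Real.sign_of_neg hy]; linarith
  · rw [hy, Real.sign_zero] at h
    rcases hs with rfl | rfl <;> norm_num at h
  · rw [← h, Real.sign_of_pos hy]; linarith

/-- Along a ray `f₀` inherits continuity and sign from `f` on `[R₁, R₂]`; off this interval it is
arbitrary, so it is replaced by the constant extension of its end values. -/
lemma exists_continuous_profile (hn : 1 ≤ n) (hR₁ : 0 < R₁) (hR : R₁ < R₂) {f : Rn n → ℝ}
    {f₀ : ℝ → ℝ} (hf : ContinuousOn f (closure (annulus O R₁ R₂)))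
    (hrad : HasRadialProfile O (closure (annulus O R₁ R₂)) f f₀) {s : ℝ} (hs : s = 1 ∨ s = -1)
    (hsgn : ∀ x ∈ closure (annulus O R₁ R₂), Real.sign (f x) = s) :
    ∃ f₁ : ℝ → ℝ, Continuous f₁ ∧ EqOn f₀ f₁ (Icc R₁ R₂) ∧ ∀ r, 0 < s * f₁ r := by
  obtain ⟨γ, hγ, hγ'⟩ := exists_unit_ray hn O hR₁ hR
  have heq : ∀ r ∈ Icc R₁ R₂, f (γ r) = f₀ r := fun r hr => by
    rw [hrad _ (hγ' r hr).1, (hγ' r hr).2]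
  have hcont : ContinuousOn f₀ (Icc R₁ R₂) :=
    (hf.comp hγ.continuousOn fun r hr => (hγ' r hr).1).congr fun r hr => (heq r hr).symm
  refine ⟨IccExtend hR.le ((Icc R₁ R₂).domRestrict f₀), hcont.domRestrict.Icc_extend',
    fun r hr => (IccExtend_of_mem hR.le ((Icc R₁ R₂).domRestrict f₀) hr).symm, fun r => ?_⟩
  have hr := (projIcc R₁ R₂ hR.le r).2
  exact sign_mul_pos hs ((congrArg Real.sign (heq _ hr)).symm.trans (hsgn _ (hγ' _ hr).1))

lemma exists_abs_le_of_profile {f : Rn n → ℝ} {f₁ : ℝ → ℝ}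
    (hrad : HasRadialProfile O (closure (annulus O R₁ R₂)) f f₁) (hf₁ : Continuous f₁) :
    ∃ B, ∀ x ∈ annulus O R₁ R₂, |f x| ≤ B := by
  obtain ⟨B, hB⟩ := (isCompact_Icc (a := R₁) (b := R₂)).exists_bound_of_continuousOn
    hf₁.continuousOn
  refine ⟨B, fun x hx => ?_⟩
  rw [hrad x (subset_closure hx)]
  exact hB _ (dist_mem_Icc_of_mem_closure (subset_closure hx))

end RadialData

end PLap

/-! ### Assembly -/

theorem theorem1p2 (n : ℕ) (hn : 1 ≤ n) (p : ℝ) (hp : 1 < p) (hp2 : p ≠ 2)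
    (O : PLap.Rn n) (R₁ R₂ : ℝ) (hR₁ : 0 < R₁) (hR : R₁ < R₂)
    (f : PLap.Rn n → ℝ) (f₀ : ℝ → ℝ)
    (hf : ContinuousOn f (closure (PLap.annulus O R₁ R₂)))
    (hrad : PLap.HasRadialProfile O (closure (PLap.annulus O R₁ R₂)) f f₀)
    (s : ℝ) (hs : s = 1 ∨ s = -1)
    (hsgn : ∀ x ∈ closure (PLap.annulus O R₁ R₂), Real.sign (f x) = s) :
    (∀ ε : ℝ, 0 < ε →
      (p < 2 → StrictAntiOn (PLap.Efun ε p) (Set.Ioc 0 (ε ^ (p - 2)))) ∧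
      (2 < p → StrictMonoOn (PLap.Efun ε p) (Set.Ici 0)) ∧
      Set.BijOn (PLap.Efun ε p) (PLap.Edom ε p) (Set.Ici 0)) ∧
    ∃ (C : ℝ → ℝ) (ubar : ℝ → PLap.Rn n → ℝ), ∀ ε : ℝ, 0 < ε →
      -- the constant is positive and is determined by the boundary condition at `R₂`
      0 < C ε ∧
      (∀ y : ℝ, 0 < y → (PLap.explicitProfile n ε p R₁ f₀ s y R₂ = 0 ↔ y = C ε)) ∧
      -- the explicit form
      PLap.HasRadialProfile O (closure (PLap.annulus O R₁ R₂)) (ubar ε)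
        (PLap.explicitProfile n ε p R₁ f₀ s (C ε)) ∧
      -- global minimizer over the feasible space
      ubar ε ∈ PLap.feasible p O R₁ R₂ ∧
      IsMinOn (PLap.potentialEnergy ε p (PLap.annulus O R₁ R₂) f)
        (PLap.feasible p O R₁ R₂) (ubar ε) ∧
      -- solution of the Euler–Lagrange equation
      PLap.IsEulerLagrangeSolution ε p (PLap.annulus O R₁ R₂) f (ubar ε) := by
  obtain ⟨f₁, hf₁, hfeq, hpos⟩ := PLap.exists_continuous_profile hn hR₁ hR hf hrad hs hsgn
  have hs0 : s ≠ 0 := by rcases hs with rfl | rfl <;> norm_num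
  have hrad₁ : PLap.HasRadialProfile O (closure (PLap.annulus O R₁ R₂)) f f₁ := fun x hx =>
    (hrad x hx).trans (hfeq (PLap.dist_mem_Icc_of_mem_closure hx))
  refine ⟨fun ε hε => ⟨fun h => (PLap.Efun_strictAntiOn hp h).mono fun r hr => hr.1,
    fun h => PLap.Efun_strictMonoOn h, PLap.Efun_bijOn hε hp hp2⟩, ?_⟩
  have hC : ∀ ε : ℝ, ∃ C, 0 < ε →
      0 < C ∧ ∀ y, ∫ ρ in R₁..R₂, PLap.slope n ε p R₁ s f₁ y ρ = 0 ↔ y = C := by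
    intro ε
    by_cases hε : 0 < ε
    · obtain ⟨C, h⟩ :=
        PLap.exists_unique_slope_integral_eq_zero (n := n) hε hp hp2 hR₁ hR hf₁ hpos
      exact ⟨C, fun _ => h⟩
    · exact ⟨0, fun h => absurd h hε⟩
  choose C hC using hC
  refine ⟨C, fun ε x => ∫ ρ in R₁..dist x O, s * PLap.slope n ε p R₁ s f₁ (C ε) ρ,
    fun ε hε => ?_⟩
  obtain ⟨hC0, hCu⟩ := hC ε hε
  have hslope : Continuous fun ρ => s * PLap.slope n ε p R₁ s f₁ (C ε) ρ :=
    PLap.continuous_mul_slope hε hp hp2 hR₁ hf₁ _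
  have hbdry : ∫ ρ in R₁..R₂, s * PLap.slope n ε p R₁ s f₁ (C ε) ρ = 0 := by
    rw [intervalIntegral.integral_const_mul, (hCu _).2 rfl, mul_zero]
  have hprofile : PLap.HasRadialProfile O (closure (PLap.annulus O R₁ R₂))
      (fun x => ∫ ρ in R₁..dist x O, s * PLap.slope n ε p R₁ s f₁ (C ε) ρ)
      (PLap.explicitProfile n ε p R₁ f₀ s (C ε)) := fun x hx =>
    (PLap.explicitProfile_eq hs hfeq (PLap.dist_mem_Icc_of_mem_closure hx)).symm
  have hW := PLap.memW1pZero_radial hp O hR₁ hR hslope hbdry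
  have hsol := PLap.isEulerLagrangeSolution_radial hn hε hp hp2 hR₁ hs hf₁ hbdry hrad₁
  refine ⟨hC0, fun y _ => ?_, hprofile, ⟨hW, ?_, _, hprofile⟩, ?_, hsol⟩
  · rw [PLap.explicitProfile_eq hs hfeq (right_mem_Icc.2 hR.le),
      intervalIntegral.integral_const_mul, mul_eq_zero, or_iff_right hs0, hCu]
  · exact ((PLap.contDiff_one_primitive hslope R₁).continuous.comp
      (continuous_id.dist continuous_const)).continuousOn
  · have hfin := PLap.isFiniteMeasure_restrict_annulus O R₁ R₂
    have hΩ := PLap.isOpen_annulus O R₁ R₂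
    obtain ⟨A, hA⟩ :=
      PLap.exists_norm_flux_le (O := O) (R₂ := R₂) hε hp hp2 hR₁ hs hf₁ (C ε)
    obtain ⟨B, hB⟩ := PLap.exists_abs_le_of_profile hrad₁ hf₁
    -- Minimality over all of `W₀^{1,p}` restricts to the feasible space.
    exact (hsol.isMinOn hε hp hp2 hΩ hW hA hB
      ((hf.mono subset_closure).aestronglyMeasurable hΩ.measurableSet)).on_subset fun v hv => hv.1
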